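/- Fix an integer $k \ge 3$ and real constants $\alpha > 0$, $c > 0$. For a $k$-regular simple graph $G$ on $n$ vertices (the vertices are the bins), consider the following allocation of $n$ balls, one at each time $t = 0, 1, \dots, n-1$, into initially empty bins. Put $m = \lfloor c \log n \rfloor$. Two walkers $W_1, W_2$ move on $G$ independently of each other: at each of the times $0, m, 2m, \dots$ each walker is (re)set to a fresh uniformly random vertex, all these vertices being independent; between consecutive resets each walker performs a non-backtracking simple random walk, i.e. its first step after a reset goes to a uniformly random neighbour of its current vertex, and every later step goes to a uniformly random neighbour of its current vertex other than the vertex occupied one step before. The walkers' paths may intersect. The ball of time $t$ is put into the less loaded of the bins $W_1(t)$ and $W_2(t)$; ties are broken by an arbitrary deterministic rule, which may depend on the positions of the walkers at times $0, \dots, t$. Then there is a constant $C = C(k, \alpha, c)$ such that, whenever $G$ has girth at least $2\lceil \alpha \log_{k-1} n \rceil + 1$, the maximum load of a bin after all $n$ balls are placed is at most $\log_2 \log n + C$ with high probability, i.e. with probability tending to $1$ as $n \to \infty$, uniformly over all such graphs $G$ and all tie-breaking rules: for every $\varepsilon > 0$ there is $n_0 = n_0(\varepsilon, k, \alpha, c)$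 such that for all $n \ge n_0$, every such $G$ on $n$ vertices and every tie-breaking rule, the probability is at least $1 - \varepsilon$. -/

import Mathlib

/-- A uniformly random element of the finite set `s`. The value `stuck` is used only if `s` is
empty, which cannot happen for the sets occurring below on a graph of minimum degree at least 2. -/
noncomputable def uniformFrom {V : Type*} (s : Finset V) (stuck : V) : PMF V :=
  open scoped Classical in
  if h : s.Nonempty then PMF.uniformOfFinset s h else PMF.pure stuck

/-- Law of the next position of one walker that is reset every `m` steps. The list `past` holds
the positions at times `t - 1, t - 2, …, 0` (most recent first), where `t = past.length`; its
first `t % m` entries are the positions visited since the last reset.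
* At a reset time (`m ∣ t`) the next position is a uniform vertex.
* One step after a reset it is a uniform neighbour of the current vertex.
* Otherwise it is a uniform neighbour of the current vertex `u` other than the previous
  vertex `v` (non-backtracking step). -/
noncomputable def nextVertex {V : Type*} [Fintype V] [DecidableEq V] [Nonempty V]
    (G : SimpleGraph V) [DecidableRel G.Adj] (m : ℕ) (past : List V) : PMF V :=
  match past.take (past.length % m) with
  | [] => PMF.uniformOfFintype V
  | [u] => uniformFrom (G.neighborFinset u) u
  | u :: v :: _ => uniformFrom ((G.neighborFinset u).erase v) u

/-- Joint law of the positions `(W₁(s), W₂(s))`, `s = t - 1, …, 0` (most recent first), of two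
walkers moving independently of each other, both reset at the times `0, m, 2m, …`. -/
noncomputable def walkersLaw {V : Type*} [Fintype V] [DecidableEq V] [Nonempty V]
    (G : SimpleGraph V) [DecidableRel G.Adj] (m : ℕ) : ℕ → PMF (List (V × V))
  | 0 => PMF.pure []
  | t + 1 =>
    (walkersLaw G m t).bind fun h =>
      (nextVertex G m (h.map Prod.fst)).bind fun a =>
        (nextVertex G m (h.map Prod.snd)).bind fun b =>
          PMF.pure ((a, b) :: h)

/-- Loads of the bins after the balls have been placed along the history `h` of walker positions
(most recent first), starting with empty bins: each ball goes to the less loaded of the two bins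
at the walkers' current positions. Ties are broken by an arbitrary deterministic rule `tie`,
which may look at the whole history of positions up to and including the current ones. -/
def loads {V : Type*} [DecidableEq V] (tie : List (V × V) → Bool) : List (V × V) → V → ℕ
  | [] => fun _ => 0
  | (a, b) :: h =>
    let q := loads tie h
    let target :=
      if q a < q b then a
      else if q b < q a then b
      else if tie ((a, b) :: h) then a else b
    Function.update q target (q target + 1)

/-- The maximum load over all bins. -/
def maxLoad {V : Type*} [Fintype V] [DecidableEq V] (tie : List (V × V) → Bool)
    (h : List (V × V)) : ℕ :=
  Finset.univ.sup (loads tie h)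

/-! Time is cut into epochs of length `m`, at whose starts both walkers are reset. A
non-backtracking walk on a regular graph started from a uniform vertex stays uniform
(`expect_walkIter_topTwo`), so for a set `A` of bins fixed at the start of an epoch and any single
time of that epoch, both walkers are in `A` with probability exactly `(|A|/n)^2`, whatever happened
in earlier epochs. This is the estimate for two independent choices that drives the usual layered
induction, but the heavy bins have to be frozen for a whole epoch.

Freezing is legitimate in an epoch in which no vertex is visited twice: each visited bin then still
has its initial load. Large girth makes other epochs rare. Two short non-backtracking walks with the
same ends coincide, so a walker returns to a vertex only after more than `r` steps, and then with
probability at most `(k-1)^(-r)`; the two walkers meet at given times with probability `1/n`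
(`toOuterMeasure_pairIter_not_collisionFree_le`). The probability of a bad epoch is thus at most `q
= n^(-2a)` for a small constant `a`, and a bad epoch adds at most `m` bins to a level.

Since the conditional bounds hold for every past, the number of epochs with a given event has
binomial-type tails. For a fixed offset inside the epoch there is at most one event per epoch, so
the dependence along a walk plays no role; offsets are handled by a union bound. If at most `β n`
bins reach load `l`, at most `16 β^2 n` reach load `l + 1`, as long as `β ≥ n^(-a)`. Starting from
`1/32` at load 64, the fraction drops below `n^(-a)` after at most `log_2 log n + 2` levels
(`toOuterMeasure_levelBound_lt_le`).

From there the collision error blocks further squaring, and each bin is treated separately. To rise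
much higher a bin must be visited while the other walker is at a heavy bin; the probability that
this happens in `L` epochs is `O(n^(-a L))`, which beats a union bound over bins for constant `L`.
By the girth each such epoch adds only boundedly many balls to the bin (`loads_le_epochCount`), so
only a constant is lost. -/

/-! ### Short non-backtracking walks in graphs of large girth -/

/-- The list `l` is the vertex sequence of a non-backtracking walk. -/
def SimpleGraph.IsNonBacktracking {V : Type*} (G : SimpleGraph V) : List V → Prop
  | [] => True
  | [_] => True
  | u :: v :: l => G.Adj u v ∧ l.head? ≠ some u ∧ G.IsNonBacktracking (v :: l)

namespace SimpleGraph

variable {V : Type*} {G : SimpleGraph V}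

lemma IsNonBacktracking.tail {u : V} {l : List V} (h : G.IsNonBacktracking (u :: l)) :
    G.IsNonBacktracking l := by
  match l with
  | [] => trivial
  | _ :: _ => exact h.2.2

lemma IsNonBacktracking.drop {l : List V} (h : G.IsNonBacktracking l) (i : ℕ) :
    G.IsNonBacktracking (l.drop i) := by
  induction i generalizing l with
  | zero => simpa using h
  | succ i ih =>
    match l with
    | [] => simpa using h
    | u :: l => simpa using ih h.tail

lemma IsNonBacktracking.take {l : List V} (h : G.IsNonBacktracking l) (i : ℕ) :
    G.IsNonBacktracking (l.take i) := by
  induction l generalizing i with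
  | nil => simpa using h
  | cons u l ih =>
    match l, i with
    | _, 0 => trivial
    | [], i + 1 => simpa using h
    | v :: l, 1 => simp [IsNonBacktracking]
    | v :: l, i + 2 =>
      refine ⟨h.1, ?_, by simpa using ih h.2.2 (i + 1)⟩
      have := h.2.1
      cases l <;> cases i <;> simp_all

lemma IsNonBacktracking.exists_walk {u w : V} {l : List V} (h : G.IsNonBacktracking (u :: l))
    (hw : (u :: l).getLast? = some w) :
    ∃ p : G.Walk u w, p.support = u :: l ∧ p.edges.IsChain (· ≠ ·) := by
  induction l generalizing u with
  | nil =>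
    obtain rfl : u = w := by simpa using hw
    exact ⟨.nil, by simp⟩
  | cons v l ih =>
    obtain ⟨p, hp, hc⟩ := ih h.2.2 (by simpa using hw)
    refine ⟨Walk.cons h.1 p, by simp [hp], ?_⟩
    cases p with
    | nil => simp
    | @cons _ x _ hvw q =>
      simp only [Walk.edges_cons, List.isChain_cons_cons] at hc ⊢
      refine ⟨?_, hc⟩
      intro he
      have huw : u = x := by
        rcases Sym2.eq_iff.1 he with ⟨h1, h2⟩ | ⟨h1, -⟩
        · exact absurd h1 h.1.ne
        · exact h1
      have hl : l = q.support := by simpa using hp.symm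
      apply h.2.1
      rw [hl, huw]
      cases q <;> simp

/-- Two walks with the same ends that do not backtrack coincide if they are short compared with
the girth. -/
lemma Walk.eq_of_isChain_edges_of_lt_egirth {u v : V} {p q : G.Walk u v}
    (hp : p.edges.IsChain (· ≠ ·)) (hq : q.edges.IsChain (· ≠ ·))
    (h : ((p.length + q.length : ℕ) : ℕ∞) < G.egirth) :
    p = q ∧ p.IsPath := by
  classical
  -- The edges of both walks span a subgraph with fewer edges than the girth, hence a forest. In a
  -- forest non-backtracking walks are paths, and paths are determined by their ends.
  let H : SimpleGraph V := fromEdgeSet {e | e ∈ p.edges ++ q.edges}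
  have hHG : H ≤ G := by
    intro a b hab
    rw [fromEdgeSet_adj] at hab
    rcases List.mem_append.1 hab.1 with h1 | h1
    · exact p.adj_of_mem_edges h1
    · exact q.adj_of_mem_edges h1
  have hmem : ∀ e ∈ G.edgeSet, e ∈ p.edges ++ q.edges → e ∈ H.edgeSet := by
    intro e he h1
    rw [edgeSet_fromEdgeSet]
    exact ⟨h1, by simpa using G.not_isDiag_of_mem_edgeSet he⟩
  have hH : H.IsAcyclic := by
    intro a c hc
    have h1 : c.length ≤ p.length + q.length := by
      have hsub : c.edges.toFinset ⊆ (p.edges ++ q.edges).toFinset := by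
        intro e he
        have := c.edges_subset_edgeSet (List.mem_toFinset.1 he)
        rw [edgeSet_fromEdgeSet] at this
        exact List.mem_toFinset.2 this.1
      have := (Finset.card_le_card hsub).trans (List.toFinset_card_le _)
      rw [List.toFinset_card_of_nodup hc.edges_nodup] at this
      simpa using this
    have h2 := egirth_le_length (hc.mapLe hHG)
    rw [Walk.length_map] at h2
    exact absurd (h2.trans (by exact_mod_cast h1)) (not_le.2 h)
  have hpH : ∀ e ∈ p.edges, e ∈ H.edgeSet := fun e he =>
    hmem e (p.edges_subset_edgeSet he) (List.mem_append_left _ he)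
  have hqH : ∀ e ∈ q.edges, e ∈ H.edgeSet := fun e he =>
    hmem e (q.edges_subset_edgeSet he) (List.mem_append_right _ he)
  have hp' : (p.transfer H hpH).IsPath :=
    (hH.isPath_iff_isChain _).2 (by simpa using hp)
  have hq' : (q.transfer H hqH).IsPath :=
    (hH.isPath_iff_isChain _).2 (by simpa using hq)
  have heq := congrArg Subtype.val
    ((hH.subsingleton_path u v).elim ⟨_, hp'⟩ ⟨_, hq'⟩)
  refine ⟨?_, ?_⟩
  · apply Walk.ext_support
    have := congrArg Walk.support heq
    simpa using this
  · rw [Walk.isPath_def] at hp' ⊢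
    simpa using hp'

/-- Uniqueness applied to the walk and itself: twice its length is at most `2 * r`, below the girth.
-/
lemma IsNonBacktracking.nodup {l : List V} (h : G.IsNonBacktracking l) {r : ℕ}
    (hr : ((2 * r + 1 : ℕ) : ℕ∞) ≤ G.egirth) (hl : l.length ≤ r + 1) : l.Nodup := by
  match l with
  | [] => simp
  | u :: l =>
    obtain ⟨p, hp, hc⟩ := h.exists_walk (List.getLast?_eq_some_getLast (List.cons_ne_nil _ _))
    have hlen := congrArg List.length hp
    rw [Walk.length_support] at hlen
    have := (Walk.eq_of_isChain_edges_of_lt_egirth hc hc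
      (lt_of_lt_of_le (by simp only [List.length_cons] at *; exact_mod_cast (by omega)) hr)).2
    rw [Walk.isPath_def, hp] at this
    exact this

/-- The last `r` steps are forced by their two ends. This makes a late return to a given vertex a
single event of probability at most `(k-1)^(-r)`. -/
lemma IsNonBacktracking.eq_of_append_cons {u : V} {l e e' : List V} {r : ℕ}
    (hr : ((2 * r + 1 : ℕ) : ℕ∞) ≤ G.egirth) (he : G.IsNonBacktracking (e ++ u :: l))
    (he' : G.IsNonBacktracking (e' ++ u :: l)) (hle : e.length = r) (hle' : e'.length = r)
    (h : (e ++ u :: l).head? = (e' ++ u :: l).head?) : e = e' := by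
  match e, e' with
  | [], [] => rfl
  | [], _ :: _ => simp at *; omega
  | _ :: _, [] => simp at *; omega
  | x :: e, y :: e' =>
    obtain rfl : x = y := by simpa using h
    have key : ∀ e : List V, (x :: e).length = r → G.IsNonBacktracking (x :: e ++ u :: l) →
        ∃ p : G.Walk x u, p.support = x :: (e ++ [u]) ∧ p.edges.IsChain (· ≠ ·) := by
      intro e hle he
      refine IsNonBacktracking.exists_walk ?_ (by simp [List.getLast?_cons])
      have := he.take (r + 1)
      rwa [← hle, List.take_length_add_append] at this
    obtain ⟨p, hp, hpc⟩ := key e hle he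
    obtain ⟨q, hq, hqc⟩ := key e' hle' he'
    have hlp := congrArg List.length hp
    have hlq := congrArg List.length hq
    simp only [Walk.length_support, List.length_cons, List.length_append, List.length_nil]
      at hlp hlq hle hle'
    have := congrArg Walk.support (Walk.eq_of_isChain_edges_of_lt_egirth hpc hqc
      (lt_of_lt_of_le (by exact_mod_cast (by omega)) hr)).1
    simpa [hp, hq] using this

/-- Returns of a non-backtracking walk to a vertex are separated by more than half the girth. -/
lemma IsNonBacktracking.lt_of_getElem?_eq {l : List V} (h : G.IsNonBacktracking l) {r i d : ℕ}
    (hr : ((2 * r + 1 : ℕ) : ℕ∞) ≤ G.egirth) (hd : 0 < d) (hi : i + d < l.length)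
    (hid : l[i]? = l[i + d]?) : r < d := by
  by_contra! hle
  have h1 := ((h.drop i).take (d + 1)).nodup hr (by simp; omega)
  have h2 := (List.nodup_iff_getElem?_ne_getElem?.1 h1) 0 d hd (by simp; omega)
  apply h2
  simp [hid]

end SimpleGraph

/-- If equal entries of a list are at distance more than `r`, then no entry occurs often. -/
lemma List.mul_count_le_of_forall_lt {V : Type*} [DecidableEq V] (r : ℕ) (v : V) (l : List V)
    (h : ∀ i d, 0 < d → i + d < l.length → l[i]? = l[i + d]? → r < d) :
    r * l.count v ≤ l.length + r := by
  induction hn : l.length using Nat.strong_induction_on generalizing l with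
  | _ n ih =>
    match l with
    | [] => simp
    | x :: l =>
      have hdrop : ∀ j, ∀ i d, 0 < d → i + d < ((x :: l).drop j).length →
          ((x :: l).drop j)[i]? = ((x :: l).drop j)[i + d]? → r < d := by
        intro j i d hd hi he
        simp only [List.length_drop, List.getElem?_drop] at hi he
        refine h (j + i) d hd (by omega) ?_
        rw [he, Nat.add_assoc]
      simp only [List.length_cons] at hn
      by_cases hx : x = v
      · subst hx
        have hnot : x ∉ l.take r := by
          intro hmem
          obtain ⟨j, hj, hjx⟩ := List.mem_iff_getElem.1 hmem
          simp only [List.length_take] at hj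
          have := h 0 (j + 1) (by omega) (by simp; omega) (by
            simp only [Nat.zero_add, List.getElem?_cons_succ, List.getElem?_cons_zero]
            rw [List.getElem?_eq_getElem (by omega)]
            simpa using hjx.symm)
          omega
        -- After an occurrence the next `r` entries are free of it, so the induction jumps over `r +
        -- 1` entries at the cost of one occurrence.
        have hc : (x :: l).count x = 1 + (l.drop r).count x := by
          conv_lhs => rw [← List.take_append_drop r l]
          rw [List.count_cons_self, List.count_append, List.count_eq_zero_of_not_mem hnot]
          omega
        have := ih (l.drop r).length (by simp; omega) (l.drop r)
          (by simpa using hdrop (r + 1)) rfl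
        rw [hc, Nat.mul_add]
        simp only [List.length_drop] at this
        rcases le_or_gt r l.length with hle | hlt
        · omega
        · rw [List.drop_of_length_le hlt.le]
          simp
      · rw [List.count_cons_of_ne hx]
        have := ih l.length (by omega) l (by simpa using hdrop 1) rfl
        omega

/-! ### Expectations with respect to a probability mass function -/

open scoped ENNReal

namespace PMF

variable {α β : Type*}

/-- The expectation of `f` under `p`. -/
noncomputable def expect (p : PMF α) (f : α → ℝ≥0∞) : ℝ≥0∞ := ∑' a, p a * f a

lemma expect_pure (a : α) (f : α → ℝ≥0∞) : (PMF.pure a).expect f = f a := by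
  rw [expect, tsum_eq_single a]
  · simp
  · intro b hb
    simp [PMF.pure_apply_of_ne _ _ hb]

lemma expect_bind (p : PMF α) (q : α → PMF β) (f : β → ℝ≥0∞) :
    (p.bind q).expect f = p.expect fun a => (q a).expect f := by
  simp only [expect, PMF.bind_apply, ← ENNReal.tsum_mul_right, ← ENNReal.tsum_mul_left]
  rw [ENNReal.tsum_comm]
  simp only [mul_assoc]

lemma expect_mono {p : PMF α} {f g : α → ℝ≥0∞} (h : ∀ a ∈ p.support, f a ≤ g a) :
    p.expect f ≤ p.expect g := by
  refine ENNReal.tsum_le_tsum fun a => ?_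
  by_cases ha : a ∈ p.support
  · exact mul_le_mul_right (h a ha) _
  · simp [(p.apply_eq_zero_iff a).2 ha]

lemma expect_congr {p : PMF α} {f g : α → ℝ≥0∞} (h : ∀ a ∈ p.support, f a = g a) :
    p.expect f = p.expect g :=
  le_antisymm (expect_mono fun a ha => (h a ha).le) (expect_mono fun a ha => (h a ha).ge)

lemma expect_const (p : PMF α) (c : ℝ≥0∞) : p.expect (fun _ => c) = c := by
  rw [expect, ENNReal.tsum_mul_right, p.tsum_coe, one_mul]

lemma expect_add (p : PMF α) (f g : α → ℝ≥0∞) :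
    (p.expect fun a => f a + g a) = p.expect f + p.expect g := by
  simp only [expect, mul_add, ENNReal.tsum_add]

lemma expect_const_mul (p : PMF α) (c : ℝ≥0∞) (f : α → ℝ≥0∞) :
    (p.expect fun a => c * f a) = c * p.expect f := by
  simp only [expect, ← ENNReal.tsum_mul_left]
  exact tsum_congr fun a => by ring

lemma expect_mul_const (p : PMF α) (c : ℝ≥0∞) (f : α → ℝ≥0∞) :
    (p.expect fun a => f a * c) = p.expect f * c := by
  simpa only [mul_comm] using p.expect_const_mul c f

lemma expect_sum {ι : Type*} (p : PMF α) (s : Finset ι) (f : ι → α → ℝ≥0∞) :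
    (p.expect fun a => ∑ i ∈ s, f i a) = ∑ i ∈ s, p.expect (f i) := by
  classical
  induction s using Finset.induction_on with
  | empty => simp [expect_const]
  | insert i s hi ih => simp only [Finset.sum_insert hi, expect_add, ih]

lemma toOuterMeasure_eq_expect (p : PMF α) (s : Set α) :
    p.toOuterMeasure s = p.expect (s.indicator 1) := by
  rw [toOuterMeasure_apply]
  refine tsum_congr fun a => ?_
  by_cases ha : a ∈ s <;> simp [ha]

lemma toOuterMeasure_add_compl (p : PMF α) (s : Set α) :
    p.toOuterMeasure s + p.toOuterMeasure sᶜ = 1 := by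
  rw [toOuterMeasure_eq_expect, toOuterMeasure_eq_expect, ← expect_add, ← p.expect_const 1]
  congr 1
  funext a
  by_cases ha : a ∈ s <;> simp [ha]

/-- Markov's inequality. -/
lemma mul_toOuterMeasure_le_expect (p : PMF α) (f : α → ℝ≥0∞) (c : ℝ≥0∞) :
    c * p.toOuterMeasure {a | c ≤ f a} ≤ p.expect f := by
  rw [toOuterMeasure_eq_expect, ← expect_const_mul]
  refine expect_mono fun a _ => ?_
  by_cases ha : c ≤ f a <;> simp [Set.indicator, ha]

lemma toOuterMeasure_bind_eq_expect (p : PMF α) (q : α → PMF β) (s : Set β) :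
    (p.bind q).toOuterMeasure s = p.expect fun a => (q a).toOuterMeasure s := by
  simp only [toOuterMeasure_eq_expect, expect_bind]

lemma expect_uniformOfFintype [Fintype α] [Nonempty α] (f : α → ℝ≥0∞) :
    (PMF.uniformOfFintype α).expect f = (Fintype.card α : ℝ≥0∞)⁻¹ * ∑ a, f a := by
  simp [expect, tsum_fintype, Finset.mul_sum]

lemma expect_uniformOfFinset (s : Finset α) (hs : s.Nonempty) (f : α → ℝ≥0∞) :
    (PMF.uniformOfFinset s hs).expect f = (s.card : ℝ≥0∞)⁻¹ * ∑ a ∈ s, f a := by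
  rw [expect, tsum_eq_sum (s := s), Finset.mul_sum]
  · exact Finset.sum_congr rfl fun a ha => by rw [PMF.uniformOfFinset_apply_of_mem hs ha]
  · intro a ha
    rw [PMF.uniformOfFinset_apply_of_notMem hs ha, zero_mul]

end PMF

lemma expect_uniformFrom {V : Type*} {s : Finset V} (hs : s.Nonempty) (x : V)
    (f : V → ℝ≥0∞) :
    (uniformFrom s x).expect f = (s.card : ℝ≥0∞)⁻¹ * ∑ a ∈ s, f a := by
  rw [uniformFrom, dif_pos hs, PMF.expect_uniformOfFinset]

lemma mem_of_mem_support_uniformFrom {V : Type*} {s : Finset V} (hs : s.Nonempty) {x a : V}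
    (h : a ∈ (uniformFrom s x).support) : a ∈ s := by
  rw [uniformFrom, dif_pos hs] at h
  exact (PMF.mem_support_uniformOfFinset_iff hs a).1 h

/-! ### A single walker -/

section Walk

lemma take_length_mod {V : Type*} {m : ℕ} {e l : List V} (hm : m ∣ l.length)
    (he : e.length < m) : (e ++ l).take ((e ++ l).length % m) = e := by
  obtain ⟨j, hj⟩ := hm
  rw [List.length_append, hj, Nat.add_mul_mod_self_left, Nat.mod_eq_of_lt he, List.take_left]

lemma nonempty_neighborFinset {V : Type*} [Fintype V] {G : SimpleGraph V} [DecidableRel G.Adj]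
    {k : ℕ} (hG : G.IsRegularOfDegree k) (hk : 3 ≤ k) (u : V) :
    (G.neighborFinset u).Nonempty := by
  rw [← Finset.card_pos, G.card_neighborFinset_eq_degree, hG u]
  omega

lemma le_card_neighborFinset_erase {V : Type*} [Fintype V] [DecidableEq V] {G : SimpleGraph V}
    [DecidableRel G.Adj] {k : ℕ} (hG : G.IsRegularOfDegree k) (u v : V) :
    k - 1 ≤ ((G.neighborFinset u).erase v).card := by
  have := Finset.pred_card_le_card_erase (s := G.neighborFinset u) (a := v)
  rwa [G.card_neighborFinset_eq_degree, hG u] at this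

lemma nonempty_neighborFinset_erase {V : Type*} [Fintype V] [DecidableEq V] {G : SimpleGraph V}
    [DecidableRel G.Adj] {k : ℕ} (hG : G.IsRegularOfDegree k) (hk : 3 ≤ k) (u v : V) :
    ((G.neighborFinset u).erase v).Nonempty := by
  have := le_card_neighborFinset_erase hG u v
  rw [← Finset.card_pos]
  omega

variable {V : Type*} [Fintype V] [DecidableEq V] [Nonempty V]
  (G : SimpleGraph V) [DecidableRel G.Adj] (m : ℕ)

/-- The law of the history after one more step of the walker. -/
noncomputable def walkStep (l : List V) : PMF (List V) :=
  (nextVertex G m l).bind fun a => PMF.pure (a :: l)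

/-- The law of the history after `s` more steps of the walker. -/
noncomputable def walkIter : ℕ → List V → PMF (List V)
  | 0, l => PMF.pure l
  | s + 1, l => (walkIter s l).bind (walkStep G m)

lemma walkIter_add (s t : ℕ) (l : List V) :
    walkIter G m (s + t) l = (walkIter G m s l).bind (walkIter G m t) := by
  induction t with
  | zero => exact (PMF.bind_pure _).symm
  | succ t ih => rw [← Nat.add_assoc, walkIter, ih, PMF.bind_bind]; rfl

lemma expect_walkStep (l : List V) (f : List V → ℝ≥0∞) :
    (walkStep G m l).expect f = (nextVertex G m l).expect fun a => f (a :: l) := by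
  rw [walkStep, PMF.expect_bind]
  simp only [PMF.expect_pure]

variable {G m}

lemma mem_support_walkStep {l l' : List V} :
    l' ∈ (walkStep G m l).support ↔ ∃ a ∈ (nextVertex G m l).support, l' = a :: l := by
  simp [walkStep]

lemma exists_append_of_mem_support_walkIter {s : ℕ} {l l' : List V}
    (h : l' ∈ (walkIter G m s l).support) : ∃ e : List V, e.length = s ∧ l' = e ++ l := by
  induction s generalizing l' with
  | zero => exact ⟨[], rfl, by simpa [walkIter] using h⟩
  | succ s ih =>
    rw [walkIter, PMF.mem_support_bind_iff] at h
    obtain ⟨l₁, h1, h2⟩ := h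
    obtain ⟨e, rfl, rfl⟩ := ih h1
    obtain ⟨a, -, rfl⟩ := mem_support_walkStep.1 h2
    exact ⟨a :: e, rfl, rfl⟩

/-- Histories grow at the head, so dropping `i` entries undoes the last `i` steps. -/
lemma expect_walkIter_drop {s : ℕ} {i : ℕ} (hi : i ≤ s) (l : List V) (f : List V → ℝ≥0∞) :
    ((walkIter G m s l).expect fun l' => f (l'.drop i)) = (walkIter G m (s - i) l).expect f := by
  conv_lhs => rw [show s = (s - i) + i by omega, walkIter_add, PMF.expect_bind]
  refine PMF.expect_congr fun l₁ _ => ?_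
  rw [← PMF.expect_const (walkIter G m i l₁) (f l₁)]
  refine PMF.expect_congr fun l' hl' => ?_
  obtain ⟨e, he, rfl⟩ := exists_append_of_mem_support_walkIter hl'
  rw [← he, List.drop_left]

variable {k : ℕ}

lemma isNonBacktracking_of_mem_support_walkIter (hG : G.IsRegularOfDegree k) (hk : 3 ≤ k)
    {s : ℕ} {l e : List V} (hl : m ∣ l.length) (hs : s ≤ m) (he : e.length = s)
    (h : e ++ l ∈ (walkIter G m s l).support) : G.IsNonBacktracking e := by
  induction s generalizing e with
  | zero =>
    obtain rfl := List.eq_nil_of_length_eq_zero he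
    trivial
  | succ s ih =>
    rw [walkIter, PMF.mem_support_bind_iff] at h
    obtain ⟨l₁, h1, h2⟩ := h
    obtain ⟨e', he', rfl⟩ := exists_append_of_mem_support_walkIter h1
    obtain ⟨a, ha, hea⟩ := mem_support_walkStep.1 h2
    have h3 := ih (by omega) he' h1
    obtain rfl : e = a :: e' := List.append_cancel_right (by simpa using hea)
    rw [nextVertex, take_length_mod hl (by omega)] at ha
    match e', ha, h3 with
    | [], _, _ => trivial
    | [u], ha, _ =>
      have := mem_of_mem_support_uniformFrom (nonempty_neighborFinset hG hk u) ha
      rw [SimpleGraph.mem_neighborFinset] at this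
      exact ⟨this.symm, by simp, trivial⟩
    | u :: v :: e', ha, h3 =>
      have := mem_of_mem_support_uniformFrom (nonempty_neighborFinset_erase hG hk u v) ha
      rw [Finset.mem_erase, SimpleGraph.mem_neighborFinset] at this
      exact ⟨this.2.symm, by simpa using this.1.symm, h3⟩

/-- The value of `f` at the last two positions of a history. -/
def topTwo (f : V → V → ℝ≥0∞) : List V → ℝ≥0∞
  | u :: v :: _ => f u v
  | _ => 0

/-- The uniform law on directed edges is stationary for the non-backtracking step: every directed
edge has `k - 1` successors and `k - 1` predecessors. Positions alone are not a Markov chain, hence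
the statement about the last two. -/
lemma expect_walkIter_topTwo (hG : G.IsRegularOfDegree k) (hk : 3 ≤ k) {s : ℕ} {l : List V}
    (hl : m ∣ l.length) (hs : s + 2 ≤ m) (f : V → V → ℝ≥0∞) :
    (walkIter G m (s + 2) l).expect (topTwo f) =
      (Fintype.card V : ℝ≥0∞)⁻¹ * (k : ℝ≥0∞)⁻¹ *
        ∑ u, ∑ v ∈ G.neighborFinset u, f u v := by
  have hsymm : ∀ g : V → V → ℝ≥0∞, ∑ u, ∑ v ∈ G.neighborFinset u, g u v =
      ∑ u, ∑ v ∈ G.neighborFinset u, g v u := by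
    intro g
    refine Finset.sum_comm' fun u v => ?_
    simp [G.adj_comm]
  induction s generalizing f with
  | zero =>
    have h1 : nextVertex G m l = PMF.uniformOfFintype V := by
      have := take_length_mod (V := V) (e := []) hl (by simpa using (by omega : 0 < m))
      simp only [List.nil_append] at this
      rw [nextVertex, this]
    have h2 : ∀ u, nextVertex G m (u :: l) = uniformFrom (G.neighborFinset u) u := by
      intro u
      have := take_length_mod (V := V) (e := [u]) hl (by simpa using (by omega : 1 < m))
      simp only [List.singleton_append] at this
      rw [nextVertex, this]
    simp only [walkIter, PMF.pure_bind, PMF.expect_bind, expect_walkStep, h1, h2, topTwo,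
      PMF.expect_uniformOfFintype, expect_uniformFrom (nonempty_neighborFinset hG hk _),
      G.card_neighborFinset_eq_degree, hG.degree_eq]
    rw [hsymm f, ← Finset.mul_sum, mul_assoc]
  | succ s ih =>
    rw [walkIter, PMF.expect_bind]
    trans (walkIter G m (s + 2) l).expect
      (topTwo fun u v => ((k - 1 : ℕ) : ℝ≥0∞)⁻¹ * ∑ w ∈ (G.neighborFinset u).erase v, f w u)
    · refine PMF.expect_congr fun l₁ h1 => ?_
      obtain ⟨e', he', rfl⟩ := exists_append_of_mem_support_walkIter h1
      have h3 := isNonBacktracking_of_mem_support_walkIter hG hk hl (by omega) he' h1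
      rw [expect_walkStep, nextVertex, take_length_mod hl (by omega)]
      match e', he', h3 with
      | u :: v :: e', _, h3 =>
        simp only [topTwo, List.cons_append]
        rw [expect_uniformFrom (nonempty_neighborFinset_erase hG hk _ _),
          Finset.card_erase_of_mem (by simpa using h3.1), G.card_neighborFinset_eq_degree,
          hG.degree_eq]
    · rw [ih (by omega)]
      congr 1
      rw [hsymm f]
      refine Finset.sum_congr rfl fun u _ => ?_
      rw [← Finset.mul_sum]
      have h1 : ∑ v ∈ G.neighborFinset u, ∑ w ∈ (G.neighborFinset u).erase v, f w u =
          ∑ w ∈ G.neighborFinset u, ∑ v ∈ (G.neighborFinset u).erase w, f w u := by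
        refine Finset.sum_comm' fun v w => ?_
        simp only [Finset.mem_erase]
        tauto
      rw [h1, Finset.mul_sum]
      refine Finset.sum_congr rfl fun w hw => ?_
      rw [Finset.sum_const, Finset.card_erase_of_mem hw, G.card_neighborFinset_eq_degree,
        hG.degree_eq, nsmul_eq_mul, ← mul_assoc, ENNReal.inv_mul_cancel, one_mul]
      · exact Nat.cast_ne_zero.2 (by omega)
      · exact ENNReal.natCast_ne_top _

/-- The value of `f` at the last position of a history. -/
def atHead (f : V → ℝ≥0∞) (l : List V) : ℝ≥0∞ := l.head?.elim 0 f

/-- The position of the walker is uniform at any time. -/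
lemma expect_walkIter_atHead (hG : G.IsRegularOfDegree k) (hk : 3 ≤ k) {s : ℕ} {l : List V}
    (hl : m ∣ l.length) (hs : s + 1 ≤ m) (f : V → ℝ≥0∞) :
    (walkIter G m (s + 1) l).expect (atHead f) = (Fintype.card V : ℝ≥0∞)⁻¹ * ∑ u, f u := by
  rcases s with _ | s
  · have h1 : nextVertex G m l = PMF.uniformOfFintype V := by
      have := take_length_mod (V := V) (e := []) hl hs
      simp only [List.nil_append] at this
      rw [nextVertex, this]
    simp [walkIter, expect_walkStep, h1, PMF.expect_uniformOfFintype, atHead]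
  · trans (walkIter G m (s + 2) l).expect (topTwo fun u _ => f u)
    · refine PMF.expect_congr fun l₁ h1 => ?_
      obtain ⟨e', he', rfl⟩ := exists_append_of_mem_support_walkIter h1
      match e', he' with
      | u :: v :: e', _ => simp [atHead, topTwo]
    · rw [expect_walkIter_topTwo hG hk hl hs, mul_assoc]
      congr 1
      rw [Finset.mul_sum]
      refine Finset.sum_congr rfl fun w hw => ?_
      rw [Finset.sum_const, G.card_neighborFinset_eq_degree,
        hG.degree_eq, nsmul_eq_mul, ← mul_assoc, ENNReal.inv_mul_cancel, one_mul]
      · exact Nat.cast_ne_zero.2 (by omega)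
      · exact ENNReal.natCast_ne_top _

lemma expect_walkIter_getElem? (hG : G.IsRegularOfDegree k) (hk : 3 ≤ k) {i : ℕ} {l : List V}
    (hl : m ∣ l.length) (hi : i < m) (f : V → ℝ≥0∞) :
    ((walkIter G m m l).expect fun l' => l'[i]?.elim 0 f) =
      (Fintype.card V : ℝ≥0∞)⁻¹ * ∑ u, f u := by
  rw [← expect_walkIter_atHead hG hk hl (s := m - i - 1) (by omega),
    show m - i - 1 + 1 = m - i by omega, ← expect_walkIter_drop hi.le]
  simp [atHead]

/-- Within an epoch, no continuation of the history by `r` steps is likely. -/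
lemma expect_walkIter_indicator_singleton_le (hG : G.IsRegularOfDegree k) (hk : 3 ≤ k)
    {r : ℕ} {l : List V} (hl : 1 ≤ l.length % m) (hr : l.length % m + r ≤ m) (x : List V) :
    (walkIter G m r l).expect (Set.indicator {x} 1) ≤ (((k - 1 : ℕ) : ℝ≥0∞)⁻¹) ^ r := by
  induction r generalizing x with
  | zero =>
    refine (PMF.expect_mono (g := fun _ => 1) fun a _ => ?_).trans (by simp [PMF.expect_const])
    exact Set.indicator_le_self' (by simp) a
  | succ r ih =>
    rw [walkIter, PMF.expect_bind, pow_succ]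
    refine le_trans (PMF.expect_mono (g := fun l₁ =>
      Set.indicator {x.tail} 1 l₁ * (((k - 1 : ℕ) : ℝ≥0∞)⁻¹)) fun l₁ h1 => ?_) ?_
    · rw [expect_walkStep]
      by_cases hx : l₁ = x.tail
      · subst hx
        rw [Set.indicator_of_mem (Set.mem_singleton _), Pi.one_apply, one_mul]
        obtain ⟨e, he, hel⟩ := exists_append_of_mem_support_walkIter h1
        have hlen : x.tail.length % m = l.length % m + r := by
          rw [hel, List.length_append, he, Nat.add_mod, Nat.add_comm,
            Nat.mod_eq_of_lt (a := r) (by omega), Nat.mod_eq_of_lt (by omega)]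
        -- No reset falls within these steps, so each one is uniform on at least `k - 1` vertices;
        -- the case right after a reset has `k` of them.
        have key : ∀ (t : Finset V) (z : V), k - 1 ≤ t.card →
            ((uniformFrom t z).expect fun a =>
              Set.indicator {x} (1 : List V → ℝ≥0∞) (a :: x.tail)) ≤
              (((k - 1 : ℕ) : ℝ≥0∞)⁻¹) := by
          intro t z ht
          have htn : t.Nonempty := Finset.card_pos.1 (by omega)
          rw [expect_uniformFrom htn]
          have hsum : ∑ a ∈ t, Set.indicator {x} (1 : List V → ℝ≥0∞) (a :: x.tail) ≤ 1 := by
            match x with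
            | [] => simp
            | b :: x =>
              simp only [Set.indicator, Set.mem_singleton_iff, List.tail_cons, List.cons.injEq,
                and_true, Pi.one_apply, Finset.sum_ite_eq']
              split_ifs <;> simp
          calc _ ≤ (t.card : ℝ≥0∞)⁻¹ * 1 := by gcongr
            _ ≤ _ := by rw [mul_one]; gcongr
        rw [nextVertex]
        have hne : x.tail.take (x.tail.length % m) ≠ [] := by
          intro h
          have := congrArg List.length h
          rw [List.length_take, hlen, List.length_nil] at this
          have : 0 < x.tail.length := by
            by_contra! h0
            rw [Nat.le_zero.1 h0, Nat.zero_mod] at hlen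
            omega
          omega
        split
        · contradiction
        · exact key _ _ (by rw [G.card_neighborFinset_eq_degree, hG.degree_eq]; omega)
        · exact key _ _ (le_card_neighborFinset_erase hG _ _)
      · rw [← PMF.expect_const (nextVertex G m l₁) (_ * _)]
        refine PMF.expect_mono fun a _ => ?_
        rw [Set.indicator_of_notMem]
        · exact zero_le
        · rintro rfl
          exact hx rfl
    · rw [PMF.expect_mul_const]
      gcongr
      exact ih (by omega) x.tail

/-- Within an epoch, the walker is unlikely to be at the same vertex at two given times. -/
lemma toOuterMeasure_walkIter_getElem?_eq_le (hG : G.IsRegularOfDegree k) (hk : 3 ≤ k)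
    {r : ℕ} (hr : ((2 * r + 1 : ℕ) : ℕ∞) ≤ G.egirth) {l : List V} (hl : m ∣ l.length)
    {i d : ℕ} (hd : 0 < d) (hi : i + d < m) :
    (walkIter G m m l).toOuterMeasure {l' | l'[i]? = l'[i + d]?} ≤
      (((k - 1 : ℕ) : ℝ≥0∞)⁻¹) ^ r := by
  rw [PMF.toOuterMeasure_eq_expect]
  trans ((walkIter G m m l).expect fun l' =>
      Set.indicator {x : List V | x[0]? = x[d]?} 1 (l'.drop i))
  · refine PMF.expect_mono fun l' _ => ?_
    simp [Set.indicator]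
  rw [expect_walkIter_drop (by omega)]
  have hm0 : l.length % m = 0 := Nat.mod_eq_zero_of_dvd hl
  rcases le_or_gt d r with hdr | hdr
  · refine (PMF.expect_mono (g := fun _ => 0) fun l' hl' => ?_).trans
      (by simp [PMF.expect_const])
    obtain ⟨e, he, rfl⟩ := exists_append_of_mem_support_walkIter hl'
    have hnb := isNonBacktracking_of_mem_support_walkIter hG hk hl (by omega) he hl'
    rw [Set.indicator_of_notMem]
    intro h
    have h' : e[0]? = e[0 + d]? := by
      simp only [Set.mem_ofPred_eq] at h
      rwa [List.getElem?_append_left (by omega), List.getElem?_append_left (by omega),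
        ← Nat.zero_add d] at h
    have := hnb.lt_of_getElem?_eq hr hd (by omega) h'
    omega
  -- The walk is stopped `r` steps before the later time. As `d > r`, the vertex to be hit is
  -- already in the past, and at most one continuation of length `r` reaches it.
  · rw [show m - i = (m - i - r) + r by omega, walkIter_add, PMF.expect_bind]
    refine (PMF.expect_mono (g := fun _ => (((k - 1 : ℕ) : ℝ≥0∞)⁻¹) ^ r) fun l₁ h1 => ?_).trans
      (by rw [PMF.expect_const])
    obtain ⟨e, he, rfl⟩ := exists_append_of_mem_support_walkIter h1
    rcases Nat.eq_zero_or_pos r with rfl | hr0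
    · refine (PMF.expect_mono (g := fun _ => 1) fun a _ => ?_).trans (by simp [PMF.expect_const])
      exact Set.indicator_le_self' (by simp) a
    have hmod : (e ++ l).length % m = m - i - r := by
      rw [List.length_append, Nat.add_mod, hm0, he, Nat.add_zero, Nat.mod_mod]
      exact Nat.mod_eq_of_lt (by omega)
    by_cases hex : ∃ x ∈ (walkIter G m r (e ++ l)).support, x[0]? = x[d]?
    · obtain ⟨x, hx, hxd⟩ := hex
      refine (PMF.expect_mono (g := Set.indicator {x} 1) fun y hy => ?_).trans
        (expect_walkIter_indicator_singleton_le hG hk (by omega) (by omega) x)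
      by_cases hyd : y[0]? = y[d]?
      · suffices y = x by
          rw [this, Set.indicator_of_mem (Set.mem_singleton x)]
          simp [Set.indicator, hxd]
        have hnb : ∀ z : List V, z ++ (e ++ l) ∈ (walkIter G m r (e ++ l)).support →
            z.length = r → G.IsNonBacktracking (z ++ e) := by
          intro z hz hzr
          refine isNonBacktracking_of_mem_support_walkIter (m := m) hG hk hl
            (s := m - i) (by omega) (by rw [List.length_append]; omega) ?_
          rw [show m - i = (m - i - r) + r by omega, walkIter_add, PMF.mem_support_bind_iff]
          exact ⟨_, h1, by rwa [List.append_assoc]⟩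
        obtain ⟨e₁, he₁, rfl⟩ := exists_append_of_mem_support_walkIter hx
        obtain ⟨e₂, he₂, rfl⟩ := exists_append_of_mem_support_walkIter hy
        have hn₁ := hnb e₁ hx he₁
        have hn₂ := hnb e₂ hy he₂
        rw [List.getElem?_append_right (i := d) (by omega), he₁] at hxd
        rw [List.getElem?_append_right (i := d) (by omega), he₂, ← hxd] at hyd
        match e, he with
        | [], he => simp at he; omega
        | u :: e, _ =>
          rw [hn₂.eq_of_append_cons hr hn₁ he₂ he₁ ?_]
          simp only [List.head?_eq_getElem?]
          rwa [List.getElem?_append_left (by omega), List.getElem?_append_left (by omega)] at hyd ⊢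
      · simp [Set.indicator, hyd]
    · push Not at hex
      refine (PMF.expect_mono (g := fun _ => 0) fun y hy => ?_).trans (by simp [PMF.expect_const])
      simp [Set.indicator, hex y hy]

end Walk

/-! ### A pair of independent walkers -/

section Pair

variable {V : Type*} [Fintype V] [DecidableEq V] [Nonempty V]
  (G : SimpleGraph V) [DecidableRel G.Adj] (m : ℕ)

/-- The law of the history after one more step of both walkers. -/
noncomputable def pairStep (h : List (V × V)) : PMF (List (V × V)) :=
  (nextVertex G m (h.map Prod.fst)).bind fun a =>
    (nextVertex G m (h.map Prod.snd)).bind fun b => PMF.pure ((a, b) :: h)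

/-- The law of the history after `s` more steps of both walkers. -/
noncomputable def pairIter : ℕ → List (V × V) → PMF (List (V × V))
  | 0, h => PMF.pure h
  | s + 1, h => (pairIter s h).bind (pairStep G m)

lemma walkersLaw_add (t s : ℕ) :
    walkersLaw G m (t + s) = (walkersLaw G m t).bind (pairIter G m s) := by
  induction s with
  | zero => exact (PMF.bind_pure _).symm
  | succ s ih =>
    rw [← Nat.add_assoc, walkersLaw, ih, PMF.bind_bind]
    rfl

variable {G m}

lemma exists_append_of_mem_support_pairIter {s : ℕ} {h h' : List (V × V)}
    (hh : h' ∈ (pairIter G m s h).support) :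
    ∃ e : List (V × V), e.length = s ∧ h' = e ++ h ∧
      e.map Prod.fst ++ h.map Prod.fst ∈ (walkIter G m s (h.map Prod.fst)).support ∧
      e.map Prod.snd ++ h.map Prod.snd ∈ (walkIter G m s (h.map Prod.snd)).support := by
  induction s generalizing h' with
  | zero => exact ⟨[], rfl, by simpa [pairIter] using hh, by simp [walkIter], by simp [walkIter]⟩
  | succ s ih =>
    rw [pairIter, PMF.mem_support_bind_iff] at hh
    obtain ⟨l₁, h1, h2⟩ := hh
    obtain ⟨e, rfl, rfl, h3, h4⟩ := ih h1
    simp only [pairStep, PMF.mem_support_bind_iff, PMF.mem_support_pure_iff] at h2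
    obtain ⟨a, ha, b, hb, rfl⟩ := h2
    refine ⟨(a, b) :: e, rfl, rfl, ?_, ?_⟩
    · rw [walkIter, PMF.mem_support_bind_iff]
      exact ⟨_, h3, mem_support_walkStep.2 ⟨a, by simpa using ha, rfl⟩⟩
    · rw [walkIter, PMF.mem_support_bind_iff]
      exact ⟨_, h4, mem_support_walkStep.2 ⟨b, by simpa using hb, rfl⟩⟩

lemma length_eq_of_mem_support_walkersLaw {t : ℕ} {h : List (V × V)}
    (hh : h ∈ (walkersLaw G m t).support) : h.length = t := by
  rw [← Nat.zero_add t, walkersLaw_add, PMF.mem_support_bind_iff] at hh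
  obtain ⟨h₁, h1, h2⟩ := hh
  obtain rfl : h₁ = [] := by simpa [walkersLaw] using h1
  obtain ⟨e, he, rfl, -⟩ := exists_append_of_mem_support_pairIter h2
  simpa using he

/-- The two walkers are independent. -/
lemma expect_pairIter_mul (s : ℕ) (h : List (V × V)) (f g : List V → ℝ≥0∞) :
    ((pairIter G m s h).expect fun h' => f (h'.map Prod.fst) * g (h'.map Prod.snd)) =
      (walkIter G m s (h.map Prod.fst)).expect f * (walkIter G m s (h.map Prod.snd)).expect g := by
  induction s generalizing f g with
  | zero => simp [pairIter, walkIter, PMF.expect_pure]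
  | succ s ih =>
    simp only [pairIter, walkIter, PMF.expect_bind]
    rw [← ih]
    refine PMF.expect_congr fun h₁ _ => ?_
    simp only [pairStep, PMF.expect_bind, PMF.expect_pure, List.map_cons, PMF.expect_const_mul,
      PMF.expect_mul_const, expect_walkStep]

lemma expect_pairIter_fst (s : ℕ) (h : List (V × V)) (f : List V → ℝ≥0∞) :
    ((pairIter G m s h).expect fun h' => f (h'.map Prod.fst)) =
      (walkIter G m s (h.map Prod.fst)).expect f := by
  simpa [PMF.expect_const] using expect_pairIter_mul (G := G) (m := m) s h f fun _ => 1

lemma expect_pairIter_snd (s : ℕ) (h : List (V × V)) (f : List V → ℝ≥0∞) :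
    ((pairIter G m s h).expect fun h' => f (h'.map Prod.snd)) =
      (walkIter G m s (h.map Prod.snd)).expect f := by
  simpa [PMF.expect_const] using expect_pairIter_mul (G := G) (m := m) s h (fun _ => 1) f

variable {k : ℕ}

lemma expect_pairIter_getElem? (hG : G.IsRegularOfDegree k) (hk : 3 ≤ k) {i j : ℕ}
    {h : List (V × V)} (hl : m ∣ h.length) (hi : i < m) (hj : j < m) (f g : V → ℝ≥0∞) :
    ((pairIter G m m h).expect fun h' =>
      (h'.map Prod.fst)[i]?.elim 0 f * (h'.map Prod.snd)[j]?.elim 0 g) =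
      ((Fintype.card V : ℝ≥0∞)⁻¹ * ∑ u, f u) * ((Fintype.card V : ℝ≥0∞)⁻¹ * ∑ u, g u) := by
  rw [expect_pairIter_mul m h (fun l => l[i]?.elim 0 f) (fun l => l[j]?.elim 0 g),
    expect_walkIter_getElem? hG hk (by simpa using hl) hi,
    expect_walkIter_getElem? hG hk (by simpa using hl) hj]

lemma toOuterMeasure_pairIter_getElem?_mem (hG : G.IsRegularOfDegree k) (hk : 3 ≤ k) {i : ℕ}
    {h : List (V × V)} (hl : m ∣ h.length) (hi : i < m) (A B : Finset V) :
    (pairIter G m m h).toOuterMeasure {h' | ∃ x ∈ h'[i]?, x.1 ∈ A ∧ x.2 ∈ B} =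
      ((Fintype.card V : ℝ≥0∞)⁻¹ * A.card) * ((Fintype.card V : ℝ≥0∞)⁻¹ * B.card) := by
  have := expect_pairIter_getElem? hG hk hl hi hi (fun u => if u ∈ A then 1 else 0)
    (fun u => if u ∈ B then 1 else 0)
  simp only [Finset.sum_boole, Finset.filter_univ_mem] at this
  rw [← this, PMF.toOuterMeasure_eq_expect]
  refine PMF.expect_congr fun h' _ => ?_
  rcases hx : h'[i]? with _ | ⟨a, b⟩
  · simp [Set.indicator, hx]
  · by_cases h1 : a ∈ A <;> by_cases h2 : b ∈ B <;> simp [Set.indicator, hx, h1, h2]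

lemma toOuterMeasure_pairIter_getElem?_eq (hG : G.IsRegularOfDegree k) (hk : 3 ≤ k) {i j : ℕ}
    {h : List (V × V)} (hl : m ∣ h.length) (hi : i < m) (hj : j < m) :
    (pairIter G m m h).toOuterMeasure
      {h' | ∃ x, (h'.map Prod.fst)[i]? = some x ∧ (h'.map Prod.snd)[j]? = some x} =
      (Fintype.card V : ℝ≥0∞)⁻¹ := by
  rw [PMF.toOuterMeasure_eq_expect]
  trans (pairIter G m m h).expect fun h' => ∑ v : V,
      (h'.map Prod.fst)[i]?.elim 0 (fun u => if u = v then 1 else 0) *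
        (h'.map Prod.snd)[j]?.elim 0 (fun u => if u = v then 1 else 0)
  · refine PMF.expect_congr fun h' _ => ?_
    rcases h1 : (h'.map Prod.fst)[i]? with _ | x
    · simp only [Set.indicator, Set.mem_ofPred_eq, h1]
      simp
    · rcases h2 : (h'.map Prod.snd)[j]? with _ | y
      · simp only [Set.indicator, Set.mem_ofPred_eq, h1, h2]
        simp
      · simp only [Set.indicator, Set.mem_ofPred_eq, h1, h2]
        simp [eq_comm]
  · rw [PMF.expect_sum]
    simp only [expect_pairIter_getElem? hG hk hl hi hj]
    simp only [Finset.sum_ite_eq', Finset.mem_univ, if_true, Finset.sum_const, Finset.card_univ,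
      nsmul_eq_mul, mul_one]
    rw [← mul_assoc, ENNReal.mul_inv_cancel (by simp) (by simp), one_mul]

/-- A history is collision-free in its last epoch if no vertex was visited twice in that epoch,
by the same walker or by different ones. -/
def CollisionFree (m : ℕ) (h : List (V × V)) : Prop :=
  ((h.take m).map Prod.fst ++ (h.take m).map Prod.snd).Nodup

/-- A union bound over at most `m ^ 2` pairs of times for each of the three kinds of collision: two
within a walker, one between walkers. -/
lemma toOuterMeasure_pairIter_not_collisionFree_le (hG : G.IsRegularOfDegree k) (hk : 3 ≤ k)
    {r : ℕ} (hr : ((2 * r + 1 : ℕ) : ℕ∞) ≤ G.egirth) {h : List (V × V)} (hl : m ∣ h.length) :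
    (pairIter G m m h).toOuterMeasure {h' | ¬ CollisionFree m h'} ≤
      (m : ℝ≥0∞) ^ 2 * (2 * (((k - 1 : ℕ) : ℝ≥0∞)⁻¹) ^ r + (Fintype.card V : ℝ≥0∞)⁻¹) := by
  let I := Finset.range m ×ˢ Finset.range m
  let J := I.filter fun p => 0 < p.2 ∧ p.1 + p.2 < m
  let S₁ : ℕ × ℕ → Set (List (V × V)) := fun p =>
    {h' | (h'.map Prod.fst)[p.1]? = (h'.map Prod.fst)[p.1 + p.2]?}
  let S₂ : ℕ × ℕ → Set (List (V × V)) := fun p =>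
    {h' | (h'.map Prod.snd)[p.1]? = (h'.map Prod.snd)[p.1 + p.2]?}
  let S₃ : ℕ × ℕ → Set (List (V × V)) := fun p =>
    {h' | ∃ x, (h'.map Prod.fst)[p.1]? = some x ∧ (h'.map Prod.snd)[p.2]? = some x}
  have hsub : (pairIter G m m h).toOuterMeasure {h' | ¬ CollisionFree m h'} ≤
      (pairIter G m m h).toOuterMeasure
        (((⋃ p ∈ J, S₁ p) ∪ ⋃ p ∈ J, S₂ p) ∪ ⋃ p ∈ I, S₃ p) := by
    refine PMF.toOuterMeasure_mono _ ?_
    rintro h' ⟨hc, hs⟩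
    obtain ⟨e, he, rfl, -⟩ := exists_append_of_mem_support_pairIter hs
    have key : ∀ f : V × V → V, ¬ (e.map f).Nodup →
        ∃ p ∈ J, ((e ++ h).map f)[p.1]? = ((e ++ h).map f)[p.1 + p.2]? := by
      intro f hf
      rw [List.nodup_iff_getElem?_ne_getElem?] at hf
      push Not at hf
      obtain ⟨i, j, hij, hj, heq⟩ := hf
      rw [List.length_map] at hj
      refine ⟨(i, j - i), ?_, ?_⟩
      · simp only [J, I, Finset.mem_filter, Finset.mem_product, Finset.mem_range]
        omega
      · simp only [List.map_append]
        rw [List.getElem?_append_left (by rw [List.length_map]; omega),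
          List.getElem?_append_left (by rw [List.length_map]; omega), heq]
        congr 1
        omega
    simp only [Set.mem_ofPred_eq, CollisionFree, ← he, List.take_left, List.nodup_append] at hc
    by_cases h1 : (e.map Prod.fst).Nodup
    · by_cases h2 : (e.map Prod.snd).Nodup
      · have h3 : ∃ a ∈ e.map Prod.fst, ∃ b ∈ e.map Prod.snd, a = b := by
          by_contra! h3
          exact hc ⟨h1, h2, h3⟩
        obtain ⟨a, ha, b, hb, rfl⟩ := h3
        obtain ⟨i, hi, hia⟩ := List.mem_iff_getElem.1 ha
        obtain ⟨j, hj, hja⟩ := List.mem_iff_getElem.1 hb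
        refine Or.inr (Set.mem_biUnion (x := (i, j)) ?_ ⟨a, ?_, ?_⟩)
        · rw [List.length_map] at hi hj
          simp only [I, Finset.coe_product, Set.mem_prod, Finset.coe_range, Set.mem_Iio]
          omega
        · rw [List.map_append, List.getElem?_append_left hi, List.getElem?_eq_getElem hi, hia]
        · rw [List.map_append, List.getElem?_append_left hj, List.getElem?_eq_getElem hj, hja]
      · obtain ⟨p, hp, hpe⟩ := key _ h2
        exact Or.inl (Or.inr (Set.mem_biUnion hp hpe))
    · obtain ⟨p, hp, hpe⟩ := key _ h1
      exact Or.inl (Or.inl (Set.mem_biUnion hp hpe))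
  have hI : (I.card : ℝ≥0∞) = (m : ℝ≥0∞) ^ 2 := by simp [I, sq]
  have hJ : (J.card : ℝ≥0∞) ≤ (m : ℝ≥0∞) ^ 2 := by
    rw [← hI]
    exact_mod_cast Finset.card_filter_le _ _
  have h1 : ∀ p ∈ J, (pairIter G m m h).toOuterMeasure (S₁ p) ≤
      (((k - 1 : ℕ) : ℝ≥0∞)⁻¹) ^ r := by
    intro p hp
    simp only [J, Finset.mem_filter] at hp
    refine le_trans (le_of_eq ?_) (toOuterMeasure_walkIter_getElem?_eq_le hG hk hr
      (l := h.map Prod.fst) (by simpa using hl) hp.2.1 hp.2.2)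
    rw [PMF.toOuterMeasure_eq_expect, PMF.toOuterMeasure_eq_expect, ← expect_pairIter_fst]
    rfl
  have h2 : ∀ p ∈ J, (pairIter G m m h).toOuterMeasure (S₂ p) ≤
      (((k - 1 : ℕ) : ℝ≥0∞)⁻¹) ^ r := by
    intro p hp
    simp only [J, Finset.mem_filter] at hp
    refine le_trans (le_of_eq ?_) (toOuterMeasure_walkIter_getElem?_eq_le hG hk hr
      (l := h.map Prod.snd) (by simpa using hl) hp.2.1 hp.2.2)
    rw [PMF.toOuterMeasure_eq_expect, PMF.toOuterMeasure_eq_expect, ← expect_pairIter_snd]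
    rfl
  have h3 : ∀ p ∈ I, (pairIter G m m h).toOuterMeasure (S₃ p) ≤ (Fintype.card V : ℝ≥0∞)⁻¹ := by
    intro p hp
    simp only [I, Finset.mem_product, Finset.mem_range] at hp
    exact (toOuterMeasure_pairIter_getElem?_eq hG hk hl hp.1 hp.2).le
  have hbound : ∀ (K : Finset (ℕ × ℕ)) (S : ℕ × ℕ → Set (List (V × V))) (c : ℝ≥0∞),
      (K.card : ℝ≥0∞) ≤ (m : ℝ≥0∞) ^ 2 →
      (∀ p ∈ K, (pairIter G m m h).toOuterMeasure (S p) ≤ c) →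
      (pairIter G m m h).toOuterMeasure (⋃ p ∈ K, S p) ≤ (m : ℝ≥0∞) ^ 2 * c := by
    intro K S c hK hc
    calc _ ≤ ∑ p ∈ K, (pairIter G m m h).toOuterMeasure (S p) :=
          MeasureTheory.measure_biUnion_finset_le _ _
      _ ≤ ∑ _p ∈ K, c := Finset.sum_le_sum hc
      _ ≤ _ := by rw [Finset.sum_const, nsmul_eq_mul]; gcongr
  calc _ ≤ _ := hsub
    _ ≤ (m : ℝ≥0∞) ^ 2 * (((k - 1 : ℕ) : ℝ≥0∞)⁻¹) ^ r +
        (m : ℝ≥0∞) ^ 2 * (((k - 1 : ℕ) : ℝ≥0∞)⁻¹) ^ r +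
        (m : ℝ≥0∞) ^ 2 * (Fintype.card V : ℝ≥0∞)⁻¹ :=
      (MeasureTheory.measure_union_le _ _).trans (add_le_add
        ((MeasureTheory.measure_union_le _ _).trans (add_le_add (hbound _ _ _ hJ h1)
          (hbound _ _ _ hJ h2))) (hbound _ _ _ hI.le h3))
    _ = _ := by ring

end Pair

/-! ### Counting epochs in which an event occurs -/

section EpochCount

open scoped Classical in
/-- The number of those of the last `j` epochs at the end of which the history lies in `A`. -/
noncomputable def epochCount {V : Type*} (m : ℕ) (A : Set (List (V × V))) :
    ℕ → List (V × V) → ℕ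
  | 0, _ => 0
  | j + 1, h => epochCount m A j (h.drop m) + if h ∈ A then 1 else 0

variable {V : Type*} [Fintype V] [DecidableEq V] [Nonempty V]
  {G : SimpleGraph V} [DecidableRel G.Adj] {m : ℕ}

/-- Each epoch multiplies the exponential moment by at most `1 + x * q`, because `q` bounds the
conditional probability for every past. No independence between epochs is needed. -/
lemma expect_pow_epochCount_le {A : Set (List (V × V))} {q : ℝ≥0∞}
    (hA : ∀ h : List (V × V), m ∣ h.length → (pairIter G m m h).toOuterMeasure A ≤ q)
    (x : ℝ≥0∞) (j : ℕ) :
    ((walkersLaw G m (j * m)).expect fun h => (1 + x) ^ epochCount m A j h) ≤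
      (1 + x * q) ^ j := by
  induction j with
  | zero => simp [epochCount, PMF.expect_const]
  | succ j ih =>
    rw [Nat.succ_mul, walkersLaw_add, PMF.expect_bind, pow_succ]
    refine le_trans (PMF.expect_mono (g := fun h => (1 + x) ^ epochCount m A j h * (1 + x * q))
      fun h hh => ?_) (by rw [PMF.expect_mul_const]; gcongr)
    trans (pairIter G m m h).expect fun h' =>
      (1 + x) ^ epochCount m A j h * (1 + x * A.indicator 1 h')
    · refine PMF.expect_mono fun h' hh' => ?_
      obtain ⟨e, he, rfl, -⟩ := exists_append_of_mem_support_pairIter hh'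
      rw [epochCount, ← he, List.drop_left, pow_add]
      by_cases hmem : e ++ h ∈ A <;> simp [hmem]
    · rw [PMF.expect_const_mul, PMF.expect_add, PMF.expect_const_mul, PMF.expect_const,
        ← PMF.toOuterMeasure_eq_expect]
      gcongr
      exact hA h (by rw [length_eq_of_mem_support_walkersLaw hh]; exact Dvd.intro_left j rfl)

/-- A Chernoff bound for the number of epochs in which an event occurs. -/
lemma pow_mul_toOuterMeasure_le_epochCount_le {A : Set (List (V × V))} {q : ℝ≥0∞}
    (hA : ∀ h : List (V × V), m ∣ h.length → (pairIter G m m h).toOuterMeasure A ≤ q)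
    (x : ℝ≥0∞) (j L : ℕ) :
    (1 + x) ^ L * (walkersLaw G m (j * m)).toOuterMeasure {h | L ≤ epochCount m A j h} ≤
      (1 + x * q) ^ j := by
  refine le_trans ?_ (expect_pow_epochCount_le hA x j)
  refine le_trans ?_ (PMF.mul_toOuterMeasure_le_expect _ _ ((1 + x) ^ L))
  gcongr
  exact fun hh => pow_le_pow_right₀ (le_self_add : (1 : ℝ≥0∞) ≤ 1 + x) hh

end EpochCount

/-! ### Loads -/

section Loads

variable {V : Type*} [DecidableEq V] (tie : List (V × V) → Bool)

lemma exists_loads_cons_eq (x : V × V) (h : List (V × V)) :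
    ∃ w, (w = x.1 ∨ w = x.2) ∧ loads tie h w ≤ loads tie h x.1 ∧ loads tie h w ≤ loads tie h x.2 ∧
      loads tie (x :: h) = Function.update (loads tie h) w (loads tie h w + 1) := by
  obtain ⟨a, b⟩ := x
  refine ⟨_, ?_, ?_, ?_, rfl⟩
  all_goals
    dsimp only
    split_ifs <;> first | omega | simp

lemma loads_le_loads_cons (x : V × V) (h : List (V × V)) (v : V) :
    loads tie h v ≤ loads tie (x :: h) v := by
  obtain ⟨w, -, -, -, hw⟩ := exists_loads_cons_eq tie x h
  rw [hw, Function.update_apply]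
  split_ifs with h1
  · rw [h1]; omega
  · rfl

lemma loads_le_loads_append (e h : List (V × V)) (v : V) :
    loads tie h v ≤ loads tie (e ++ h) v := by
  induction e with
  | nil => rfl
  | cons x e ih => exact ih.trans (loads_le_loads_cons tie x _ v)

lemma loads_append_le_count (e h : List (V × V)) (v : V) :
    loads tie (e ++ h) v ≤
      loads tie h v + ((e.map Prod.fst).count v + (e.map Prod.snd).count v) := by
  induction e with
  | nil => simp
  | cons x e ih =>
    obtain ⟨w, hx, -, -, hw⟩ := exists_loads_cons_eq tie x (e ++ h)
    rw [List.cons_append, hw, Function.update_apply]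
    simp only [List.map_cons, List.count_cons, beq_iff_eq]
    split_ifs with h1 <;>
      first | omega | (subst h1; rcases hx with rfl | rfl <;> simp_all <;> omega)

lemma loads_append_eq_of_notMem {e h : List (V × V)} {v : V} (h1 : v ∉ e.map Prod.fst)
    (h2 : v ∉ e.map Prod.snd) : loads tie (e ++ h) v = loads tie h v := by
  have := loads_append_le_count tie e h v
  rw [List.count_eq_zero_of_not_mem h1, List.count_eq_zero_of_not_mem h2] at this
  exact le_antisymm (by simpa using this) (loads_le_loads_append tie e h v)

/-- If a bin receives a ball at a large height during an epoch, then at some time one of the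
walkers is at this bin while the other one is at a bin that was heavily loaded at the start of
the epoch. -/
lemma exists_visit_of_lt_loads_append {i D : ℕ} {e h : List (V × V)} {v : V}
    (hD : ∀ u, loads tie (e ++ h) u ≤ loads tie h u + D)
    (hv : loads tie h v < loads tie (e ++ h) v) (hi : i + D < loads tie (e ++ h) v) :
    ∃ x ∈ e, (x.1 = v ∧ i ≤ loads tie h x.2) ∨ (x.2 = v ∧ i ≤ loads tie h x.1) := by
  induction e with
  | nil => simp at hv
  | cons x e ih =>
    have hD' : ∀ u, loads tie (e ++ h) u ≤ loads tie h u + D := fun u =>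
      (loads_le_loads_cons tie x _ u).trans (hD u)
    obtain ⟨w, hx, ha, hb, hw⟩ := exists_loads_cons_eq tie x (e ++ h)
    rw [List.cons_append, hw, Function.update_apply] at hv hi
    -- The latest ball is peeled off. If it fell into `v`, both candidate bins had load at least `i
    -- + D` then, hence at least `i` at the start of the epoch.
    by_cases hvw : v = w
    · subst hvw
      rw [if_pos rfl] at hi
      refine ⟨x, List.mem_cons_self, ?_⟩
      have h1 := hD' x.1
      have h2 := hD' x.2
      rcases hx with hx | hx
      · exact Or.inl ⟨hx.symm, by omega⟩
      · exact Or.inr ⟨hx.symm, by omega⟩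
    · rw [if_neg hvw] at hv hi
      obtain ⟨y, hy, hy'⟩ := ih hD' hv hi
      exact ⟨y, List.mem_cons_of_mem _ hy, hy'⟩

variable [Fintype V]

lemma sum_loads (h : List (V × V)) : ∑ v, loads tie h v = h.length := by
  induction h with
  | nil => simp [loads]
  | cons x h ih =>
    obtain ⟨w, -, -, -, hw⟩ := exists_loads_cons_eq tie x h
    rw [hw, Finset.sum_update_of_mem (Finset.mem_univ w), List.length_cons, ← ih,
      ← Finset.add_sum_erase _ _ (Finset.mem_univ w), Finset.sdiff_singleton_eq_erase]
    omega

/-- The set of bins of load at least `i`. -/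
def level (i : ℕ) (h : List (V × V)) : Finset V := {v | i ≤ loads tie h v}

variable {tie} in
lemma mem_level {i : ℕ} {h : List (V × V)} {v : V} : v ∈ level tie i h ↔ i ≤ loads tie h v := by
  simp [level]

lemma mul_card_level_le (i : ℕ) (h : List (V × V)) : i * (level tie i h).card ≤ h.length := by
  rw [← sum_loads tie h, Nat.mul_comm, ← smul_eq_mul]
  refine (Finset.card_nsmul_le_sum _ _ _ fun v hv => mem_level.1 hv).trans ?_
  exact Finset.sum_le_sum_of_subset (Finset.subset_univ _)

lemma level_subset_level_append (i : ℕ) (e h : List (V × V)) :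
    level tie i h ⊆ level tie i (e ++ h) := fun v hv =>
  mem_level.2 ((mem_level.1 hv).trans (loads_le_loads_append tie e h v))

/-- The ball goes to the less loaded bin, so it can create a bin of load `i + 1` only if both
candidates have load at least `i`. -/
lemma card_level_cons_le (i : ℕ) (x : V × V) (h : List (V × V)) :
    (level tie (i + 1) (x :: h)).card ≤ (level tie (i + 1) h).card +
      if x.1 ∈ level tie i h ∧ x.2 ∈ level tie i h then 1 else 0 := by
  obtain ⟨w, -, ha, hb, hw⟩ := exists_loads_cons_eq tie x h
  simp only [mem_level]
  split_ifs with hx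
  · refine (Finset.card_le_card (t := insert w (level tie (i + 1) h)) fun v hv => ?_).trans
      (Finset.card_insert_le _ _)
    rw [mem_level, hw, Function.update_apply] at hv
    rw [Finset.mem_insert, mem_level]
    split_ifs at hv with h1
    · exact Or.inl h1
    · exact Or.inr hv
  · refine Finset.card_le_card fun v hv => ?_
    rw [mem_level, hw, Function.update_apply] at hv
    rw [mem_level]
    split_ifs at hv with h1
    · omega
    · exact hv

lemma card_level_append_le (i : ℕ) (e h : List (V × V)) :
    (level tie (i + 1) (e ++ h)).card ≤ (level tie (i + 1) h).card + e.length := by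
  induction e with
  | nil => simp
  | cons x e ih =>
    refine (card_level_cons_le tie i x (e ++ h)).trans ?_
    rw [List.length_cons]
    split_ifs <;> omega

/-- Without repeated vertices, no ball of the epoch falls into a candidate bin before its visit, so
loads may be read off at the start of the epoch. -/
lemma card_level_append_le_countP {i : ℕ} {e h : List (V × V)}
    (he : (e.map Prod.fst ++ e.map Prod.snd).Nodup) :
    (level tie (i + 1) (e ++ h)).card ≤ (level tie (i + 1) h).card +
      e.countP fun x => x.1 ∈ level tie i h ∧ x.2 ∈ level tie i h := by
  induction e with
  | nil => simp
  | cons x e ih =>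
    simp only [List.map_cons, List.nodup_append, List.nodup_cons, List.mem_cons] at he
    obtain ⟨⟨h1, h2⟩, ⟨h3, h4⟩, h5⟩ := he
    have ih := ih (List.nodup_append.2 ⟨h2, h4, fun a ha b hb => h5 a (Or.inr ha) b (Or.inr hb)⟩)
    have ha : loads tie (e ++ h) x.1 = loads tie h x.1 :=
      loads_append_eq_of_notMem tie h1 fun h6 => h5 _ (Or.inl rfl) _ (Or.inr h6) rfl
    have hb : loads tie (e ++ h) x.2 = loads tie h x.2 :=
      loads_append_eq_of_notMem tie (fun h6 => h5 _ (Or.inr h6) _ (Or.inl rfl) rfl) h3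
    have := card_level_cons_le tie i x (e ++ h)
    rw [List.cons_append, List.countP_cons]
    simp only [mem_level, ha, hb, decide_eq_true_eq] at this ih ⊢
    omega

end Loads

lemma List.countP_eq_sum_range {α : Type*} (p : α → Prop) [DecidablePred p] (l : List α) :
    l.countP (fun x => p x) =
      ∑ i ∈ Finset.range l.length, if ∃ x ∈ l[i]?, p x then 1 else 0 := by
  induction l with
  | nil => simp
  | cons x l ih =>
    rw [List.countP_cons, List.length_cons, Finset.sum_range_succ', ih]
    simp

/-! ### Layered induction over the epochs -/

section LayeredInduction

lemma inv_card_mul_card_le {V : Type*} [Fintype V] [Nonempty V] {A : Finset V} {b : ℝ}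
    (h : (A.card : ℝ) ≤ b) :
    (Fintype.card V : ℝ≥0∞)⁻¹ * A.card ≤ ENNReal.ofReal (b / Fintype.card V) := by
  have : (0 : ℝ) < Fintype.card V := by exact_mod_cast Fintype.card_pos
  rw [ENNReal.ofReal_div_of_pos this, ENNReal.ofReal_natCast, div_eq_mul_inv, mul_comm]
  gcongr
  rw [← ENNReal.ofReal_natCast]
  exact ENNReal.ofReal_le_ofReal h

variable {V : Type*} [Fintype V] [DecidableEq V] [Nonempty V]
  {G : SimpleGraph V} [DecidableRel G.Adj] {m k : ℕ}

lemma toOuterMeasure_le_epochCount_le {A : Set (List (V × V))} {q : ℝ} (hq : 0 ≤ q)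
    (hA : ∀ h : List (V × V), m ∣ h.length →
      (pairIter G m m h).toOuterMeasure A ≤ ENNReal.ofReal q)
    {y : ℝ} (hy : 0 ≤ y) (N L : ℕ) :
    (walkersLaw G m (N * m)).toOuterMeasure {h | L ≤ epochCount m A N h} ≤
      ENNReal.ofReal (Real.exp (y * q * N) / (1 + y) ^ L) := by
  have h1 := pow_mul_toOuterMeasure_le_epochCount_le hA (ENNReal.ofReal y) N L
  rw [← ENNReal.ofReal_mul hy, ← ENNReal.ofReal_one, ← ENNReal.ofReal_add zero_le_one hy,
    ← ENNReal.ofReal_add zero_le_one (by positivity), ← ENNReal.ofReal_pow (by positivity),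
    ← ENNReal.ofReal_pow (by positivity)] at h1
  rw [ENNReal.ofReal_div_of_pos (by positivity), ENNReal.le_div_iff_mul_le
    (Or.inl (by simp; positivity)) (Or.inl (by simp)), mul_comm]
  refine h1.trans (ENNReal.ofReal_le_ofReal ?_)
  calc (1 + y * q) ^ N ≤ Real.exp (y * q) ^ N := by
        gcongr
        linarith [Real.add_one_le_exp (y * q)]
    _ = _ := by rw [← Real.exp_nat_mul, mul_comm]

/-- The Chernoff bound with `y = 1`; the factor 4 suffices because `2 ^ 4` exceeds `e ^ 2`. -/
lemma toOuterMeasure_four_mul_le_epochCount_le {A : Set (List (V × V))} {q : ℝ} (hq : 0 ≤ q)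
    (hA : ∀ h : List (V × V), m ∣ h.length →
      (pairIter G m m h).toOuterMeasure A ≤ ENNReal.ofReal q) (N : ℕ) :
    (walkersLaw G m (N * m)).toOuterMeasure {h | 4 * q * N ≤ epochCount m A N h} ≤
      ENNReal.ofReal (Real.exp (-(q * N))) := by
  have h1 := toOuterMeasure_le_epochCount_le hq hA zero_le_one N ⌈4 * q * N⌉₊
  simp only [Nat.ceil_le] at h1
  refine h1.trans (ENNReal.ofReal_le_ofReal ?_)
  have h2 : Real.exp (2 * (q * N)) ≤ (1 + 1) ^ ⌈4 * q * N⌉₊ := by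
    have hlog := Real.log_two_gt_d9
    calc Real.exp (2 * (q * N)) ≤ Real.exp (⌈4 * q * N⌉₊ * Real.log 2) := by
          rw [Real.exp_le_exp]
          have := Nat.le_ceil (4 * q * N)
          have h0 : 0 ≤ q * N := by positivity
          nlinarith
      _ = _ := by rw [Real.exp_nat_mul, Real.exp_log two_pos]; norm_num
  rw [div_le_iff₀ (by positivity)]
  calc Real.exp (1 * q * N) = Real.exp (-(q * N)) * Real.exp (2 * (q * N)) := by
        rw [← Real.exp_add]; ring_nf
    _ ≤ _ := by gcongr

variable (tie : List (V × V) → Bool)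

/-- `i`-th most recently, both walkers were at bins which had load at least `l` at the start of
the last epoch, and there were at most `b` such bins. -/
def bothHeavy (m l : ℕ) (b : ℝ) (i : ℕ) : Set (List (V × V)) :=
  {h | ((level tie l (h.drop m)).card : ℝ) ≤ b ∧
    ∃ x ∈ h[i]?, x.1 ∈ level tie l (h.drop m) ∧ x.2 ∈ level tie l (h.drop m)}

/-- At some time of the last epoch one of the walkers was at `v` while the other one was at a bin
which had load at least `l` at the start of the epoch, and there were at most `b` such bins. -/
def visitHeavy (m l : ℕ) (b : ℝ) (v : V) : Set (List (V × V)) :=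
  {h | ((level tie l (h.drop m)).card : ℝ) ≤ b ∧ ∃ i < m, ∃ x ∈ h[i]?,
    (x.1 = v ∧ x.2 ∈ level tie l (h.drop m)) ∨ (x.2 = v ∧ x.1 ∈ level tie l (h.drop m))}

/-- The size condition built into the event makes it empty when the level is too large, so the bound
holds for every past and no conditioning on a good past is needed. -/
lemma toOuterMeasure_pairIter_bothHeavy_le (hG : G.IsRegularOfDegree k) (hk : 3 ≤ k) {i : ℕ}
    (hi : i < m) {h : List (V × V)} (hl : m ∣ h.length) (l : ℕ) {b : ℝ} (hb : 0 ≤ b) :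
    (pairIter G m m h).toOuterMeasure (bothHeavy tie m l b i) ≤
      ENNReal.ofReal ((b / Fintype.card V) ^ 2) := by
  by_cases hlb : ((level tie l h).card : ℝ) ≤ b
  · refine ((pairIter G m m h).toOuterMeasure_mono
      (t := {h' | ∃ x ∈ h'[i]?, x.1 ∈ level tie l h ∧ x.2 ∈ level tie l h}) ?_).trans ?_
    · rintro h' ⟨⟨-, hx⟩, hs⟩
      obtain ⟨e, he, rfl, -⟩ := exists_append_of_mem_support_pairIter hs
      rwa [← he, List.drop_left] at hx
    · rw [toOuterMeasure_pairIter_getElem?_mem hG hk hl hi, ENNReal.ofReal_pow (by positivity), sq]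
      gcongr <;> exact inv_card_mul_card_le hlb
  · refine ((pairIter G m m h).toOuterMeasure_mono (t := ∅) ?_).trans (by simp)
    rintro h' ⟨⟨hx, -⟩, hs⟩
    obtain ⟨e, he, rfl, -⟩ := exists_append_of_mem_support_pairIter hs
    rw [← he, List.drop_left] at hx
    exact hlb hx

/-- At each of `m` times and for each choice of the walker at `v`, independence gives `(1 / n) * (b
/ n)`. -/
lemma toOuterMeasure_pairIter_visitHeavy_le (hG : G.IsRegularOfDegree k) (hk : 3 ≤ k)
    {h : List (V × V)} (hl : m ∣ h.length) (l : ℕ) {b : ℝ} (hb : 0 ≤ b) (v : V) :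
    (pairIter G m m h).toOuterMeasure (visitHeavy tie m l b v) ≤
      ENNReal.ofReal (2 * m * b / (Fintype.card V) ^ 2) := by
  by_cases hlb : ((level tie l h).card : ℝ) ≤ b
  · let S : ℕ → Set (List (V × V)) := fun i =>
      {h' | ∃ x ∈ h'[i]?, x.1 ∈ ({v} : Finset V) ∧ x.2 ∈ level tie l h} ∪
      {h' | ∃ x ∈ h'[i]?, x.1 ∈ level tie l h ∧ x.2 ∈ ({v} : Finset V)}
    have hS : ∀ i ∈ Finset.range m, (pairIter G m m h).toOuterMeasure (S i) ≤
        ENNReal.ofReal (2 * b / (Fintype.card V) ^ 2) := by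
      intro i hi
      rw [Finset.mem_range] at hi
      have h1 : (({v} : Finset V).card : ℝ) ≤ 1 := by simp
      refine (MeasureTheory.measure_union_le _ _).trans ?_
      rw [toOuterMeasure_pairIter_getElem?_mem hG hk hl hi,
        toOuterMeasure_pairIter_getElem?_mem hG hk hl hi]
      calc _ ≤ ENNReal.ofReal (1 / Fintype.card V) * ENNReal.ofReal (b / Fintype.card V) +
            ENNReal.ofReal (b / Fintype.card V) * ENNReal.ofReal (1 / Fintype.card V) := by
            gcongr
            all_goals first | exact inv_card_mul_card_le hlb | exact inv_card_mul_card_le h1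
        _ = _ := by
            rw [← ENNReal.ofReal_mul (by positivity), ← ENNReal.ofReal_mul (by positivity),
              ← ENNReal.ofReal_add (by positivity) (by positivity)]
            congr 1
            field_simp
            ring
    refine ((pairIter G m m h).toOuterMeasure_mono (t := ⋃ i ∈ Finset.range m, S i) ?_).trans
      ((MeasureTheory.measure_biUnion_finset_le _ _).trans ((Finset.sum_le_sum hS).trans ?_))
    · rintro h' ⟨⟨-, i, hi, x, hx, hx'⟩, hs⟩
      obtain ⟨e, he, rfl, -⟩ := exists_append_of_mem_support_pairIter hs
      rw [← he, List.drop_left] at hx'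
      refine Set.mem_biUnion (x := i) (by simpa using hi) ?_
      rcases hx' with ⟨h1, h2⟩ | ⟨h1, h2⟩
      · exact Or.inl ⟨x, hx, by simpa using h1, h2⟩
      · exact Or.inr ⟨x, hx, h2, by simpa using h1⟩
    · rw [Finset.sum_const, Finset.card_range, nsmul_eq_mul, ← ENNReal.ofReal_natCast,
        ← ENNReal.ofReal_mul (by positivity)]
      apply ENNReal.ofReal_le_ofReal
      rw [← mul_div_assoc]
      exact le_of_eq (by ring)
  · refine ((pairIter G m m h).toOuterMeasure_mono (t := ∅) ?_).trans (by simp)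
    rintro h' ⟨⟨hx, -⟩, hs⟩
    obtain ⟨e, he, rfl, -⟩ := exists_append_of_mem_support_pairIter hs
    rw [← he, List.drop_left] at hx
    exact hlb hx

/-- Levels only grow, so the size bound at the final time holds at the start of every epoch.
Collision-free epochs are charged to the offsets, the others trivially `m` each. -/
lemma card_level_succ_le_epochCount {V : Type*} [Fintype V] [DecidableEq V] {m : ℕ}
    (tie : List (V × V) → Bool) {l j : ℕ} {b : ℝ} {h : List (V × V)}
    (hh : h.length = j * m) (hb : ((level tie l h).card : ℝ) ≤ b) :
    (level tie (l + 1) h).card ≤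
      ∑ i ∈ Finset.range m, epochCount m (bothHeavy tie m l b i) j h +
        m * epochCount m {h | ¬ CollisionFree m h} j h := by
  classical
  induction j generalizing h with
  | zero =>
    obtain rfl : h = [] := List.eq_nil_of_length_eq_zero (by simpa using hh)
    simp [level, loads, epochCount]
  | succ j ih =>
    obtain ⟨e, h, rfl, he⟩ : ∃ e h₀, h = e ++ h₀ ∧ e.length = m :=
      ⟨h.take m, h.drop m, (List.take_append_drop m h).symm, by
        rw [List.length_take, hh, Nat.succ_mul]; omega⟩
    have hlh : h.length = j * m := by
      rw [List.length_append, he, Nat.succ_mul] at hh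
      omega
    have hbh : ((level tie l h).card : ℝ) ≤ b :=
      le_trans (by exact_mod_cast Finset.card_le_card (level_subset_level_append tie l e h)) hb
    have ih := ih hlh hbh
    have hdrop : (e ++ h).drop m = h := by rw [← he, List.drop_left]
    simp only [epochCount, hdrop, Finset.sum_add_distrib]
    by_cases hc : CollisionFree m (e ++ h)
    · have hc' := hc
      rw [CollisionFree, ← he, List.take_left] at hc'
      have h1 := card_level_append_le_countP tie (i := l) (h := h) hc'
      rw [List.countP_eq_sum_range, he] at h1
      have h2 : ∑ i ∈ Finset.range m,
          (if ∃ x ∈ e[i]?, x.1 ∈ level tie l h ∧ x.2 ∈ level tie l h then 1 else 0) =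
          ∑ i ∈ Finset.range m, if e ++ h ∈ bothHeavy tie m l b i then 1 else 0 := by
        refine Finset.sum_congr rfl fun i hi => ?_
        rw [Finset.mem_range] at hi
        congr 1
        simp only [bothHeavy, Set.mem_ofPred_eq, hdrop, hbh, true_and]
        rw [List.getElem?_append_left (by omega)]
      rw [h2] at h1
      simp only [Set.mem_ofPred_eq, hc, not_true_eq_false, if_false, add_zero]
      omega
    · have h1 := card_level_append_le tie l e h
      simp only [Set.mem_ofPred_eq, hc, not_false_eq_true, if_true, Nat.mul_add, mul_one]
      omega

/-- This bound is sure: by the girth each walker visits a bin at most `(m + r) / r` times in an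
epoch. -/
lemma loads_le_add_of_mem_support_pairIter (hG : G.IsRegularOfDegree k) (hk : 3 ≤ k)
    {r : ℕ} (hr0 : 0 < r) (hr : ((2 * r + 1 : ℕ) : ℕ∞) ≤ G.egirth) {h h' : List (V × V)}
    (hl : m ∣ h.length) (hh : h' ∈ (pairIter G m m h).support) (u : V) :
    loads tie h' u ≤ loads tie h u + 2 * ((m + r) / r) := by
  obtain ⟨e, he, rfl, h1, h2⟩ := exists_append_of_mem_support_pairIter hh
  have key : ∀ f : V × V → V, e.map f ++ h.map f ∈ (walkIter G m m (h.map f)).support →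
      (e.map f).count u ≤ (m + r) / r := by
    intro f hf
    have hnb := isNonBacktracking_of_mem_support_walkIter hG hk (by simpa using hl) le_rfl
      (by simpa using he) hf
    rw [Nat.le_div_iff_mul_le hr0, Nat.mul_comm]
    have := List.mul_count_le_of_forall_lt r u (e.map f)
      fun i d hd hi hid => hnb.lt_of_getElem?_eq hr hd hi hid
    rwa [List.length_map, he] at this
  have := loads_append_le_count tie e h u
  have := key _ h1
  have := key _ h2
  omega

lemma loads_le_epochCount (hG : G.IsRegularOfDegree k) (hk : 3 ≤ k)
    {r : ℕ} (hr0 : 0 < r) (hr : ((2 * r + 1 : ℕ) : ℕ∞) ≤ G.egirth) {l j : ℕ} {b : ℝ}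
    {h : List (V × V)} (hh : h ∈ (walkersLaw G m (j * m)).support)
    (hb : ((level tie l h).card : ℝ) ≤ b) (v : V) :
    loads tie h v ≤ l + 2 * ((m + r) / r) +
      2 * ((m + r) / r) * epochCount m (visitHeavy tie m l b v) j h := by
  induction j generalizing h with
  | zero =>
    obtain rfl : h = [] := List.eq_nil_of_length_eq_zero
      (by simpa using length_eq_of_mem_support_walkersLaw hh)
    simp [loads]
  | succ j ih =>
    rw [Nat.succ_mul, walkersLaw_add, PMF.mem_support_bind_iff] at hh
    obtain ⟨h, h0, hs⟩ := hh
    have hl : m ∣ h.length := by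
      rw [length_eq_of_mem_support_walkersLaw h0]
      exact Dvd.intro_left j rfl
    have hD := loads_le_add_of_mem_support_pairIter tie hG hk hr0 hr hl hs
    obtain ⟨e, he, rfl, -⟩ := exists_append_of_mem_support_pairIter hs
    have hbh : ((level tie l h).card : ℝ) ≤ b :=
      le_trans (by exact_mod_cast Finset.card_le_card (level_subset_level_append tie l e h)) hb
    have ih := ih h0 hbh
    have hdrop : (e ++ h).drop m = h := by rw [← he, List.drop_left]
    rw [epochCount, hdrop]
    split_ifs with hA
    · rw [Nat.mul_add]
      have := hD v
      omega
    -- Passing the bound would mean that `v` gained a ball in this epoch above height `l` plus the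
    -- maximal gain, which forces a heavy visit.
    · rw [add_zero]
      by_contra! hlt
      apply hA
      have hlt' : l + 2 * ((m + r) / r) < loads tie (e ++ h) v := by omega
      obtain ⟨x, hx, hx'⟩ := exists_visit_of_lt_loads_append tie hD (ih.trans_lt hlt) hlt'
      obtain ⟨i, hi, rfl⟩ := List.mem_iff_getElem.1 hx
      refine ⟨by rwa [hdrop], i, by omega, e[i], ?_, ?_⟩
      · rw [List.getElem?_append_left hi, List.getElem?_eq_getElem hi]
        rfl
      · simpa only [hdrop, mem_level] using hx'

/-! ### Doubly exponential decay of the levels, and the final step for single bins -/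

/-- The bounds on the fractions of heavily loaded bins in the layered induction. -/
noncomputable def levelBound (j : ℕ) : ℝ := (1 / 2) ^ 2 ^ j / 16

lemma levelBound_pos (j : ℕ) : 0 < levelBound j := by
  unfold levelBound
  positivity

lemma levelBound_succ (j : ℕ) : levelBound (j + 1) = 16 * levelBound j ^ 2 := by
  unfold levelBound
  rw [pow_succ 2 j, pow_mul]
  ring

/-- Outside of a set of small probability, the numbers of heavily loaded bins decrease doubly
exponentially. -/
lemma toOuterMeasure_levelBound_lt_le (hG : G.IsRegularOfDegree k) (hk : 3 ≤ k)
    {N J : ℕ} (hN : N * m ≤ 2 * Fintype.card V) {q : ℝ} (hq : 0 ≤ q)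
    (hcoll : ∀ h : List (V × V), m ∣ h.length →
      (pairIter G m m h).toOuterMeasure {h' | ¬ CollisionFree m h'} ≤ ENNReal.ofReal q)
    (hJ : ∀ j < J, q ≤ levelBound j ^ 2) :
    (walkersLaw G m (N * m)).toOuterMeasure
      {h | levelBound J * Fintype.card V < (level tie (64 + J) h).card} ≤
      ENNReal.ofReal ((J * m + 1) * Real.exp (-(q * N))) := by
  have hn0 : (0 : ℝ) < Fintype.card V := by exact_mod_cast Fintype.card_pos
  have hNm : (N * m : ℝ) ≤ 2 * Fintype.card V := by exact_mod_cast hN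
  set n : ℝ := (Fintype.card V : ℝ) with hn
  let A : ℕ × ℕ → Set (List (V × V)) := fun p =>
    bothHeavy tie m (64 + p.1) (levelBound p.1 * n) p.2
  let I := Finset.range J ×ˢ Finset.range m
  let S : ℕ × ℕ → Set (List (V × V)) := fun p =>
    {h | 4 * levelBound p.1 ^ 2 * N ≤ epochCount m (A p) N h}
  let T : Set (List (V × V)) := {h | 4 * q * N ≤ epochCount m {h | ¬ CollisionFree m h} N h}
  have hS : ∀ p ∈ I, (walkersLaw G m (N * m)).toOuterMeasure (S p) ≤
      ENNReal.ofReal (Real.exp (-(q * N))) := by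
    intro p hp
    simp only [I, Finset.mem_product, Finset.mem_range] at hp
    have := levelBound_pos p.1
    refine (toOuterMeasure_four_mul_le_epochCount_le (sq_nonneg _) (fun h hl => ?_) N).trans
      (ENNReal.ofReal_le_ofReal ?_)
    · refine (toOuterMeasure_pairIter_bothHeavy_le tie hG hk hp.2 hl (64 + p.1)
        (b := levelBound p.1 * n) (by positivity)).trans ?_
      rw [mul_div_cancel_right₀ _ hn0.ne']
    · gcongr
      exact hJ _ hp.1
  have hT : (walkersLaw G m (N * m)).toOuterMeasure T ≤ ENNReal.ofReal (Real.exp (-(q * N))) :=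
    toOuterMeasure_four_mul_le_epochCount_le hq hcoll N
  refine ((walkersLaw G m (N * m)).toOuterMeasure_mono (t := (⋃ p ∈ I, S p) ∪ T) ?_).trans ?_
  · rintro h ⟨hlt, hs⟩
    by_contra hbad
    simp only [Set.mem_union, Set.mem_iUnion, not_or, not_exists] at hbad
    obtain ⟨hbadS, hbadT⟩ := hbad
    have hlen := length_eq_of_mem_support_walkersLaw hs
    have key : ∀ j ≤ J, ((level tie (64 + j) h).card : ℝ) ≤ levelBound j * n := by
      intro j
      induction j with
      | zero =>
        intro _
        -- At most `2 * n` balls give at most `n / 32` bins of load 64, and `levelBound 0 = 1 / 32`.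
        have := mul_card_level_le tie 64 h
        rw [hlen] at this
        have : (64 * (level tie 64 h).card : ℝ) ≤ N * m := by exact_mod_cast this
        simp only [levelBound, add_zero]
        linarith
      | succ j ih =>
        intro hj
        have h1 := card_level_succ_le_epochCount tie hlen (ih (by omega))
        have h2 : ∀ i ∈ Finset.range m,
            (epochCount m (A (j, i)) N h : ℝ) ≤ 4 * levelBound j ^ 2 * N := by
          intro i hi
          have := hbadS (j, i) (Finset.mem_product.2 ⟨Finset.mem_range.2 (by omega), hi⟩)
          exact (not_le.1 this).le
        have h3 : (epochCount m {h | ¬ CollisionFree m h} N h : ℝ) ≤ 4 * levelBound j ^ 2 * N := by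
          refine (not_le.1 hbadT).le.trans ?_
          gcongr
          exact hJ j (by omega)
        have h4 := Finset.sum_le_sum h2
        rw [Finset.sum_const, Finset.card_range, nsmul_eq_mul] at h4
        have h1' : ((level tie (64 + j + 1) h).card : ℝ) ≤
            ∑ i ∈ Finset.range m, (epochCount m (A (j, i)) N h : ℝ) +
              m * epochCount m {h | ¬ CollisionFree m h} N h := by exact_mod_cast h1
        rw [levelBound_succ, ← Nat.add_assoc]
        -- Collisions cost no more than the main term as `q ≤ levelBound j ^ 2`; the factor 16 is `4
        -- + 4` times the 2 in `N * m ≤ 2 * n`.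
        calc _ ≤ _ := h1'
          _ ≤ m * (4 * levelBound j ^ 2 * N) + m * (4 * levelBound j ^ 2 * N) := by gcongr
          _ = 8 * levelBound j ^ 2 * (N * m) := by ring
          _ ≤ 8 * levelBound j ^ 2 * (2 * n) := by gcongr
          _ = _ := by ring
    exact absurd hlt (not_lt.2 (key J le_rfl))
  · refine (MeasureTheory.measure_union_le _ _).trans ((add_le_add
      ((MeasureTheory.measure_biUnion_finset_le _ _).trans (Finset.sum_le_sum hS)) hT).trans ?_)
    rw [Finset.sum_const, nsmul_eq_mul, ← ENNReal.ofReal_natCast,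
      ← ENNReal.ofReal_mul (by positivity), ← ENNReal.ofReal_add (by positivity) (by positivity)]
    apply ENNReal.ofReal_le_ofReal
    simp only [I, Finset.card_product, Finset.card_range]
    push_cast
    exact le_of_eq (by ring)

/-- Once level `64 + J` is small, a union bound over the bins excludes `L` epochs with a heavy visit
to the same bin. -/
lemma toOuterMeasure_lt_maxLoad_le (hG : G.IsRegularOfDegree k) (hk : 3 ≤ k)
    {r : ℕ} (hr0 : 0 < r) (hr : ((2 * r + 1 : ℕ) : ℕ∞) ≤ G.egirth)
    {N J : ℕ} (hN : N * m ≤ 2 * Fintype.card V) {q : ℝ} (hq : 0 ≤ q)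
    (hcoll : ∀ h : List (V × V), m ∣ h.length →
      (pairIter G m m h).toOuterMeasure {h' | ¬ CollisionFree m h'} ≤ ENNReal.ofReal q)
    (hJ : ∀ j < J, q ≤ levelBound j ^ 2) (L : ℕ) :
    (walkersLaw G m (N * m)).toOuterMeasure
      {h | 64 + J + 2 * ((m + r) / r) * (L + 1) < maxLoad tie h} ≤
      ENNReal.ofReal ((J * m + 1) * Real.exp (-(q * N)) +
        Fintype.card V * (Real.exp 1 * (4 * levelBound J) ^ L)) := by
  have hn0 : (0 : ℝ) < Fintype.card V := by exact_mod_cast Fintype.card_pos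
  have hNm : (N * m : ℝ) ≤ 2 * Fintype.card V := by exact_mod_cast hN
  set n : ℝ := (Fintype.card V : ℝ) with hn
  have hβ := levelBound_pos J
  let S : V → Set (List (V × V)) := fun v =>
    {h | L ≤ epochCount m (visitHeavy tie m (64 + J) (levelBound J * n) v) N h}
  have hS : ∀ v ∈ Finset.univ, (walkersLaw G m (N * m)).toOuterMeasure (S v) ≤
      ENNReal.ofReal (Real.exp 1 * (4 * levelBound J) ^ L) := by
    intro v _
    -- With this `y` the exponent is `N * m / (2 * n) ≤ 1`, and `(1 + y) ^ L` supplies the factor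
    -- `(4 * levelBound J) ^ L`.
    refine (toOuterMeasure_le_epochCount_le (y := (4 * levelBound J)⁻¹) ?_ (fun h hl =>
      toOuterMeasure_pairIter_visitHeavy_le tie hG hk hl (64 + J) (b := levelBound J * n)
        (by positivity) v) (by positivity) N L).trans (ENNReal.ofReal_le_ofReal ?_)
    · positivity
    · rw [div_eq_mul_inv, ← inv_pow]
      gcongr
      · rw [← hn]
        calc (4 * levelBound J)⁻¹ * (2 * m * (levelBound J * n) / n ^ 2) * N =
              (N * m) / (2 * n) := by
              field_simp
              ring
          _ ≤ 1 := by rwa [div_le_one (by positivity)]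
      · rw [inv_le_comm₀ (by positivity) (by positivity)]
        linarith
  refine ((walkersLaw G m (N * m)).toOuterMeasure_mono
    (t := {h | levelBound J * n < (level tie (64 + J) h).card} ∪
      ⋃ v ∈ (Finset.univ : Finset V), S v) ?_).trans ?_
  · rintro h ⟨hlt, hs⟩
    by_contra hbad
    simp only [Set.mem_union, Set.mem_iUnion, not_or, not_exists] at hbad
    obtain ⟨h1, h2⟩ := hbad
    rw [Set.mem_ofPred_eq, not_lt] at h1
    refine absurd (show _ < maxLoad tie h from hlt) (not_lt.2 (Finset.sup_le fun v _ => ?_))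
    refine (loads_le_epochCount tie hG hk hr0 hr hs h1 v).trans ?_
    have h3 : epochCount m (visitHeavy tie m (64 + J) (levelBound J * n) v) N h ≤ L :=
      (not_le.1 (h2 v (Finset.mem_univ v))).le
    rw [Nat.mul_add (2 * ((m + r) / r)) L 1, mul_one]
    have := Nat.mul_le_mul_left (2 * ((m + r) / r)) h3
    omega
  · refine (MeasureTheory.measure_union_le _ _).trans ((add_le_add
      (toOuterMeasure_levelBound_lt_le tie hG hk hN hq hcoll hJ)
      ((MeasureTheory.measure_biUnion_finset_le _ _).trans (Finset.sum_le_sum hS))).trans ?_)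
    rw [Finset.sum_const, nsmul_eq_mul, ← ENNReal.ofReal_natCast,
      ← ENNReal.ofReal_mul (by positivity), ← ENNReal.ofReal_add (by positivity) (by positivity)]
    rfl

/-- Loads never decrease; this allows the horizon to be rounded up to whole epochs. -/
lemma toOuterMeasure_lt_maxLoad_mono {s t : ℕ} (hst : s ≤ t) (B : ℕ) :
    (walkersLaw G m s).toOuterMeasure {h | B < maxLoad tie h} ≤
      (walkersLaw G m t).toOuterMeasure {h | B < maxLoad tie h} := by
  obtain ⟨d, rfl⟩ := Nat.exists_eq_add_of_le hst
  rw [walkersLaw_add, PMF.toOuterMeasure_bind_eq_expect, PMF.toOuterMeasure_eq_expect]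
  refine PMF.expect_mono fun h _ => ?_
  by_cases hB : B < maxLoad tie h
  · rw [PMF.toOuterMeasure_eq_expect, ← PMF.expect_const (pairIter G m d h)
      (Set.indicator _ 1 h)]
    refine PMF.expect_mono fun h' hh' => ?_
    obtain ⟨e, -, rfl, -⟩ := exists_append_of_mem_support_pairIter hh'
    have : B < maxLoad tie (e ++ h) :=
      hB.trans_le (Finset.sup_mono_fun fun v _ => loads_le_loads_append tie e h v)
    simp [Set.indicator, hB, this]
  · simp [Set.indicator, hB]

end LayeredInduction

/-! ### Asymptotics -/

/-- The least such `J` is taken. Minimality at `J - 1` gives `2 ^ (J - 1) * log 2 ≤ log n`, so `2 ^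
J ≤ 4 * log n`, which yields both upper bounds. -/
lemma exists_levelBound_lt {n a : ℝ} (hn : 3 ≤ n) (ha1 : a ≤ 1) :
    ∃ J : ℕ, levelBound J < n ^ (-a) ∧ (∀ j < J, n ^ (-a) ≤ levelBound j) ∧
      (J : ℝ) ≤ Real.logb 2 (Real.log n) + 2 ∧ (J : ℝ) ≤ 4 * Real.log n := by
  have hn0 : 0 < n := by linarith
  have hlog : 1 < Real.log n := by
    rw [Real.lt_log_iff_exp_lt hn0]
    linarith [Real.exp_one_lt_d9]
  have hex : ∃ J, levelBound J < n ^ (-a) := by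
    obtain ⟨J, hJ⟩ := exists_pow_lt_of_lt_one (Real.rpow_pos_of_pos hn0 (-a))
      (by norm_num : (1 / 2 : ℝ) < 1)
    refine ⟨J, lt_of_le_of_lt ?_ hJ⟩
    unfold levelBound
    have h1 : (1 / 2 : ℝ) ^ 2 ^ J ≤ (1 / 2) ^ J :=
      pow_le_pow_of_le_one (by norm_num) (by norm_num) Nat.lt_two_pow_self.le
    have h2 : (0 : ℝ) < (1 / 2) ^ 2 ^ J := by positivity
    linarith
  classical
  refine ⟨Nat.find hex, Nat.find_spec hex, fun j hj => not_lt.1 (Nat.find_min hex hj), ?_⟩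
  have hmin : ∀ j < Nat.find hex, n ^ (-a) ≤ levelBound j :=
    fun j hj => not_lt.1 (Nat.find_min hex hj)
  generalize Nat.find hex = J at hmin
  have key : (2 : ℝ) ^ J ≤ 4 * Real.log n := by
    rcases J with _ | J
    · simp only [pow_zero]
      linarith
    · have h1 := hmin J (by omega)
      have h2 : n⁻¹ ≤ (1 / 2) ^ 2 ^ J := by
        calc n⁻¹ = n ^ (-1 : ℝ) := (Real.rpow_neg_one n).symm
          _ ≤ n ^ (-a) := Real.rpow_le_rpow_of_exponent_le (by linarith) (by linarith)
          _ ≤ levelBound J := h1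
          _ ≤ _ := by
            unfold levelBound
            have : (0 : ℝ) < (1 / 2) ^ 2 ^ J := by positivity
            linarith
      have h3 := Real.log_le_log (by positivity) h2
      rw [Real.log_inv, Real.log_pow, one_div, Real.log_inv] at h3
      push_cast at h3
      have h4 := Real.log_two_gt_d9
      rw [pow_succ]
      have h5 : (0 : ℝ) < 2 ^ J := by positivity
      nlinarith
  constructor
  · have h1 : (J : ℝ) ≤ Real.logb 2 (4 * Real.log n) := by
      rw [Real.le_logb_iff_rpow_le one_lt_two (by positivity), Real.rpow_natCast]
      exact key
    rw [Real.logb_mul (by norm_num) (by positivity), show (4 : ℝ) = 2 ^ (2 : ℝ) by norm_num,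
      Real.logb_rpow two_pos (by norm_num)] at h1
    linarith
  · refine le_trans ?_ key
    exact_mod_cast Nat.lt_two_pow_self.le

/-- The conditions on the number of vertices that the estimates below require. -/
lemma eventually_atTop_estimates {a : ℝ} (ha : 0 < a) {c : ℝ} (hc : 0 < c) {ε : ℝ} (hε : 0 < ε)
    (L : ℕ) :
    ∀ᶠ n : ℝ in Filter.atTop, 3 ≤ n ∧ 1 ≤ c * Real.log n ∧ c * Real.log n ≤ n ∧
      3 * (c * Real.log n) ^ 2 ≤ n ^ (2 * a) ∧
      (4 * Real.log n * (c * Real.log n) + 1) * (c * Real.log n) ≤ ε / 2 * n ^ (1 / 2 : ℝ) ∧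
      Real.exp 1 * 4 ^ L ≤ ε / 2 * n := by
  have hl : Filter.Tendsto Real.log Filter.atTop Filter.atTop := Real.tendsto_log_atTop
  have hlittle : ∀ (s : ℝ), 0 < s → ∀ (p : ℕ) (K : ℝ), 0 < K →
      ∀ᶠ n : ℝ in Filter.atTop, Real.log n ^ p ≤ K * n ^ s := by
    intro s hs p K hK
    have h1 := (isLittleO_log_rpow_rpow_atTop (p : ℝ) hs).def hK
    filter_upwards [h1, Filter.eventually_ge_atTop 1] with n hn hn1
    rw [Real.rpow_natCast, Real.norm_of_nonneg (pow_nonneg (Real.log_nonneg hn1) p),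
      Real.norm_of_nonneg (by positivity)] at hn
    exact hn
  have e1 := hlittle 1 one_pos 1 (1 / c) (by positivity)
  have e2 := hlittle (2 * a) (by positivity) 2 (1 / (3 * c ^ 2)) (by positivity)
  have e3 := hlittle (1 / 2) (by norm_num) 3 (ε / 2 / ((4 * c + 1) * c)) (by positivity)
  filter_upwards [Filter.eventually_ge_atTop 3, hl.eventually_ge_atTop (1 / c),
    hl.eventually_ge_atTop 1, e1, e2, e3,
    Filter.eventually_ge_atTop (Real.exp 1 * 4 ^ L / (ε / 2))] with n h1 h2 h2' h3 h4 h5 h6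
  refine ⟨h1, ?_, ?_, ?_, ?_, ?_⟩
  · rwa [div_le_iff₀' hc] at h2
  · rw [pow_one, Real.rpow_one, one_div, inv_mul_eq_div, le_div_iff₀' hc] at h3
    exact h3
  · rw [one_div, inv_mul_eq_div, le_div_iff₀ (by positivity)] at h4
    linarith
  · rw [div_mul_eq_mul_div, le_div_iff₀ (by positivity)] at h5
    refine le_trans ?_ h5
    have h7 : 1 ≤ Real.log n ^ 2 := one_le_pow₀ h2'
    calc (4 * Real.log n * (c * Real.log n) + 1) * (c * Real.log n) ≤
        (4 * Real.log n * (c * Real.log n) + Real.log n ^ 2) * (c * Real.log n) := by gcongr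
      _ = _ := by ring
  · rwa [div_le_iff₀' (by positivity)] at h6

/-! ### Choice of the parameters and conclusion -/

theorem mainTheorem2 (k : ℕ) (hk : 3 ≤ k) (α : ℝ) (hα : 0 < α) (c : ℝ) (hc : 0 < c) :
    ∃ C : ℝ, ∀ ε : ℝ, 0 < ε → ∃ n₀ : ℕ, ∀ (n : ℕ) [NeZero n], n₀ ≤ n →
      ∀ (G : SimpleGraph (Fin n)) [DecidableRel G.Adj], G.IsRegularOfDegree k →
        ((2 * ⌈α * Real.logb ((k : ℝ) - 1) (n : ℝ)⌉₊ + 1 : ℕ) : ℕ∞) ≤ G.egirth →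
        ∀ tie : List (Fin n × Fin n) → Bool,
          1 - ε ≤ ((walkersLaw G ⌊c * Real.log (n : ℝ)⌋₊ n).toOuterMeasure
            {h | (maxLoad tie h : ℝ) ≤ Real.logb 2 (Real.log (n : ℝ)) + C}).toReal := by
  have hk1 : (1 : ℝ) < (k : ℝ) - 1 := by
    have : (3 : ℝ) ≤ k := by exact_mod_cast hk
    linarith
  have hlk : 0 < Real.log ((k : ℝ) - 1) := Real.log_pos hk1
  -- `a` is a quarter of the exponent in the probability of a collision
  set a : ℝ := min α 1 / 4 with ha_def
  have ha : 0 < a := by positivity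
  have haα : 4 * a ≤ α := by rw [ha_def]; linarith [min_le_left α 1]
  have ha1 : 4 * a ≤ 1 := by rw [ha_def]; linarith [min_le_right α 1]
  -- Large enough that `(n ^ (-a)) ^ L ≤ n ^ (-2)`, leaving room for the union bound over `n` bins.
  set L : ℕ := ⌈2 / a⌉₊ with hL
  have haL : 2 ≤ a * L := by
    have := Nat.le_ceil (2 / a)
    rw [div_le_iff₀' ha] at this
    exact this
  -- An upper bound, free of `n`, for the gain `2 * ((m + r) / r)` of a bin in one epoch: both `m`
  -- and `r` are of order `log n`.
  set D : ℝ := 2 * (c * Real.log ((k : ℝ) - 1) / α + 1) with hD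
  refine ⟨66 + D * (L + 1), fun ε hε => ?_⟩
  obtain ⟨n₀, hn₀⟩ := Filter.eventually_atTop.1 (eventually_atTop_estimates ha hc hε L)
  refine ⟨⌈n₀⌉₊, fun n _ hn G _ hG hgirth tie => ?_⟩
  obtain ⟨hn3, hm1, hmn, hcollq, htail, hlast⟩ := hn₀ n (Nat.ceil_le.1 hn)
  clear hn₀
  have hn0 : (0 : ℝ) < n := by linarith
  set m : ℕ := ⌊c * Real.log (n : ℝ)⌋₊ with hm
  set r : ℕ := ⌈α * Real.logb ((k : ℝ) - 1) (n : ℝ)⌉₊ with hr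
  have hm0 : 0 < m := Nat.floor_pos.2 hm1
  have hmle : (m : ℝ) ≤ c * Real.log n := Nat.floor_le (by linarith)
  have hmn' : m ≤ n := by exact_mod_cast hmle.trans hmn
  have hlogn : 0 < Real.log n := Real.log_pos (by linarith)
  have hr0 : 0 < r := Nat.ceil_pos.2 (mul_pos hα (Real.logb_pos hk1 (by linarith)))
  have hrle : α * Real.log n / Real.log ((k : ℝ) - 1) ≤ r := by
    rw [mul_div_assoc]
    exact Nat.le_ceil _
  have hcast : ((k - 1 : ℕ) : ℝ) = (k : ℝ) - 1 := by
    rw [Nat.cast_sub (by omega), Nat.cast_one]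
  obtain ⟨J, hJlt, hJge, hJlog, hJ4⟩ := exists_levelBound_lt (a := a) hn3 (by linarith)
  set N : ℕ := n / m + 1 with hN
  have hNm : N * m ≤ 2 * n := by
    have := Nat.div_mul_le_self n m
    rw [hN, Nat.add_mul]
    omega
  have hnN : n ≤ N * m := by
    have := Nat.lt_div_mul_add (a := n) hm0
    rw [hN, Nat.add_mul]
    omega
  -- The collision probability is at most `3 * m ^ 2 * n ^ (-4 * a)`; half of the exponent absorbs
  -- the logarithms, and the rest is the square of the threshold `n ^ (-a)` defining `J`.
  set q : ℝ := (n : ℝ) ^ (-(2 * a)) with hq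
  have hq0 : 0 ≤ q := by positivity
  have hkr : (((k - 1 : ℕ) : ℝ)⁻¹) ^ r ≤ (n : ℝ) ^ (-(4 * a)) := by
    rw [hcast, inv_pow, Real.rpow_neg hn0.le]
    gcongr
    calc (n : ℝ) ^ (4 * a) ≤ (n : ℝ) ^ α :=
          Real.rpow_le_rpow_of_exponent_le (by linarith) haα
      _ = Real.exp (Real.log n * α) := Real.rpow_def_of_pos hn0 α
      _ ≤ Real.exp (r * Real.log ((k : ℝ) - 1)) := by
          rw [Real.exp_le_exp]
          rw [div_le_iff₀ hlk] at hrle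
          linarith
      _ = _ := by rw [Real.exp_nat_mul, Real.exp_log (by linarith)]
  have hinv : (n : ℝ)⁻¹ ≤ (n : ℝ) ^ (-(4 * a)) := by
    rw [← Real.rpow_neg_one]
    exact Real.rpow_le_rpow_of_exponent_le (by linarith) (by linarith)
  have hcoll : ∀ h : List (Fin n × Fin n), m ∣ h.length →
      (pairIter G m m h).toOuterMeasure {h' | ¬ CollisionFree m h'} ≤ ENNReal.ofReal q := by
    intro h hl
    refine (toOuterMeasure_pairIter_not_collisionFree_le hG hk hgirth hl).trans ?_
    have hk0 : (0 : ℝ) < ((k - 1 : ℕ) : ℝ) := by rw [hcast]; linarith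
    have h1 : (((k - 1 : ℕ) : ℝ≥0∞)⁻¹) = ENNReal.ofReal ((k - 1 : ℕ) : ℝ)⁻¹ := by
      rw [ENNReal.ofReal_inv_of_pos hk0, ENNReal.ofReal_natCast]
    have h2 : ((n : ℝ≥0∞)⁻¹) = ENNReal.ofReal (n : ℝ)⁻¹ := by
      rw [ENNReal.ofReal_inv_of_pos hn0, ENNReal.ofReal_natCast]
    have h3 : (m : ℝ≥0∞) = ENNReal.ofReal m := (ENNReal.ofReal_natCast m).symm
    have h4 : (2 : ℝ≥0∞) = ENNReal.ofReal 2 := by simp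
    rw [Fintype.card_fin, h1, h2, h3, ← ENNReal.ofReal_pow (by positivity),
      ← ENNReal.ofReal_pow (by positivity), h4, ← ENNReal.ofReal_mul (by positivity),
      ← ENNReal.ofReal_add (by positivity) (by positivity), ← ENNReal.ofReal_mul (by positivity)]
    apply ENNReal.ofReal_le_ofReal
    calc (m : ℝ) ^ 2 * (2 * (((k - 1 : ℕ) : ℝ)⁻¹) ^ r + (n : ℝ)⁻¹) ≤
          (c * Real.log n) ^ 2 * (2 * (n : ℝ) ^ (-(4 * a)) + (n : ℝ) ^ (-(4 * a))) := by gcongr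
      _ = 3 * (c * Real.log n) ^ 2 * (n : ℝ) ^ (-(4 * a)) := by ring
      _ ≤ (n : ℝ) ^ (2 * a) * (n : ℝ) ^ (-(4 * a)) := by gcongr
      _ = q := by rw [← Real.rpow_add hn0, hq]; ring_nf
  have hqJ : ∀ j < J, q ≤ levelBound j ^ 2 := by
    intro j hj
    calc q = ((n : ℝ) ^ (-a)) ^ 2 := by
          rw [hq, ← Real.rpow_natCast, ← Real.rpow_mul hn0.le]
          push_cast
          ring_nf
      _ ≤ _ := by
          gcongr
          exact hJge j hj
  have hmain := toOuterMeasure_lt_maxLoad_le (G := G) tie hG hk hr0 hgirth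
    (N := N) (J := J) (by rwa [Fintype.card_fin]) hq0 hcoll hqJ L
  have hmono := (toOuterMeasure_lt_maxLoad_mono (G := G) (m := m) tie hnN _).trans hmain
  rw [Fintype.card_fin] at hmono
  have hfirst : (J * m + 1) * Real.exp (-(q * N)) ≤ ε / 2 := by
    -- Since `2 * a ≤ 1 / 2`, the exponent `q * N` is at least `√n / (c * log n)`, so even `exp (-x)
    -- ≤ 1 / x` beats the polylogarithmic prefactor.
    have hqN : (n : ℝ) ^ (1 / 2 : ℝ) / (c * Real.log n) ≤ q * N := by
      have h1 : (n : ℝ) / (c * Real.log n) ≤ N := by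
        rw [div_le_iff₀ (by linarith)]
        calc (n : ℝ) ≤ N * m := by exact_mod_cast hnN
          _ ≤ _ := by gcongr
      calc (n : ℝ) ^ (1 / 2 : ℝ) / (c * Real.log n) =
            (n : ℝ) ^ (-(1 / 2) : ℝ) * (n / (c * Real.log n)) := by
            rw [← mul_div_assoc, ← Real.rpow_add_one hn0.ne']
            norm_num
        _ ≤ q * N := by
            gcongr
            exact Real.rpow_le_rpow_of_exponent_le (by linarith) (by linarith)
    set x : ℝ := (n : ℝ) ^ (1 / 2 : ℝ) / (c * Real.log n) with hx
    have hx0 : 0 < x := by positivity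
    calc (J * m + 1) * Real.exp (-(q * N)) ≤
          (4 * Real.log n * (c * Real.log n) + 1) * x⁻¹ := by
          gcongr
          rw [Real.exp_neg]
          gcongr
          linarith [Real.add_one_le_exp (q * N)]
      _ ≤ _ := by
          rw [hx, inv_div, ← mul_div_assoc, div_le_iff₀ (by positivity)]
          exact htail
  have hsecond : n * (Real.exp 1 * (4 * levelBound J) ^ L) ≤ ε / 2 := by
    have := levelBound_pos J
    calc n * (Real.exp 1 * (4 * levelBound J) ^ L) ≤
          n * (Real.exp 1 * (4 * (n : ℝ) ^ (-a)) ^ L) := by gcongr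
      _ = Real.exp 1 * 4 ^ L * (n * (n : ℝ) ^ (-a * L)) := by
          rw [mul_pow, Real.rpow_mul_natCast hn0.le]
          ring
      _ ≤ Real.exp 1 * 4 ^ L * (n * (n : ℝ) ^ (-2 : ℝ)) := by
          gcongr
          · linarith
          · linarith
      _ = Real.exp 1 * 4 ^ L / n := by
          rw [Real.rpow_neg hn0.le]
          norm_num
          field_simp
      _ ≤ ε / 2 := by rwa [div_le_iff₀ hn0]
  have hfail : (walkersLaw G m n).toOuterMeasure
      {h | 64 + J + 2 * ((m + r) / r) * (L + 1) < maxLoad tie h} ≤ ENNReal.ofReal ε :=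
    hmono.trans (ENNReal.ofReal_le_ofReal (by linarith))
  have hDr : (2 * ((m + r) / r) : ℕ) ≤ D := by
    have h1 : (((m + r) / r : ℕ) : ℝ) ≤ (m + r) / r := by
      have := Nat.cast_div_le (α := ℝ) (m := m + r) (n := r)
      push_cast at this
      exact this
    have hr0' : (0 : ℝ) < r := by exact_mod_cast hr0
    have h2 : (m : ℝ) / r ≤ c * Real.log ((k : ℝ) - 1) / α := by
      rw [div_le_div_iff₀ hr0' hα]
      rw [div_le_iff₀ hlk] at hrle
      nlinarith
    rw [add_div, div_self hr0'.ne'] at h1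
    push_cast
    rw [hD]
    linarith
  have hbound : ((64 + J + 2 * ((m + r) / r) * (L + 1) : ℕ) : ℝ) ≤
      Real.logb 2 (Real.log n) + (66 + D * (L + 1)) := by
    push_cast at hDr ⊢
    have : (2 * ((m + r) / r : ℕ) : ℝ) * (L + 1) ≤ D * (L + 1) := by gcongr
    linarith
  set μ := (walkersLaw G m n).toOuterMeasure
  set S : Set (List (Fin n × Fin n)) :=
    {h | (maxLoad tie h : ℝ) ≤ Real.logb 2 (Real.log (n : ℝ)) + (66 + D * (L + 1))}
  have hS : μ Sᶜ ≤ ENNReal.ofReal ε := by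
    refine le_trans (MeasureTheory.measure_mono fun h hh => ?_) hfail
    have h1 : _ < (maxLoad tie h : ℝ) := not_le.1 hh
    exact_mod_cast hbound.trans_lt h1
  have hone : μ S + μ Sᶜ = 1 := PMF.toOuterMeasure_add_compl _ S
  have hSt : μ S ≠ ⊤ := fun h => by simp [h] at hone
  have h1 : (1 : ℝ≥0∞) ≤ ENNReal.ofReal ((μ S).toReal + ε) := by
    rw [ENNReal.ofReal_add ENNReal.toReal_nonneg hε.le, ENNReal.ofReal_toReal hSt, ← hone]
    gcongr
  rw [ENNReal.one_le_ofReal] at h1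
  linarith
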